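/- Let $\psi=\Gamma'/\Gamma$ be the digamma function, $G=\sum_{k\ge 0}\frac{(-1)^k}{(2k+1)^2}$ Catalan's constant, and $\mathrm{Li}_3$ the principal branch of the trilogarithm, i.e. the holomorphic continuation of $\sum_{k\ge 1} z^k/k^3$ from the open unit disc to $\mathbb{C}\setminus[1,\infty)$. For every integer $n\ge 0$ the series $$\Theta_2(n,1)=\sum_{k=1}^\infty (-1)^k\,\frac{\psi\left(\frac{2k+2n+5}{4}\right)-\psi\left(\frac{2k+2n+3}{4}\right)}{(2k+1)^2}$$ converges (absolutely), and its value is as follows (empty sums are $0$). (i) If $n=0$: $$\Theta_2(0,1)=-4+\left(1-\tfrac14\ln^2 2\right)\pi-\frac{\pi^3}{8}+4\,\Im\,\mathrm{Li}_3(1+i).$$ (ii) If $n=1$: $$\Theta_2(1,1)=\frac{11}{3}-\left(3-\tfrac12\ln^2 2\right)\frac{\pi}{2}+\frac{\pi^3}{8}+2G-4\,\Im\,\mathrm{Li}_3(1+i).$$ (iii) If $n$ is odd and $n\ne 1$: $$\begin{aligned}\Theta_2(n,1)={}&5-\sum_{j=1}^{\frac{n-1}{2}}\frac{1}{4j^2(4j+1)}+4\sum_{j=1}^{n}\frac{(-1)^j}{2j+1}+\frac14\sum_{k=1}^{\frac{n-1}{2}}\sum_{j=0}^{2k}\frac{(-1)^j(8k^2+4k+1)}{k^2(2j+1)(2k+1)^2}\\&+\left(2-\sum_{j=1}^{\frac{n-1}{2}}\frac{1}{j(2j+1)}\right)G-\left(3+\sum_{j=1}^{\frac{n-1}{2}}\frac{1}{(2j+1)^2}-\tfrac12\ln^2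 2\right)\frac{\pi}{2}+\frac{\pi^3}{8}-4\,\Im\,\mathrm{Li}_3(1+i).\end{aligned}$$ (iv) If $n$ is even: $$\begin{aligned}\Theta_2(n,1)={}&-4+\frac14\sum_{j=1}^{\frac n2}\frac{1}{j^2(4j-1)}-4\sum_{j=1}^{n}\frac{(-1)^j}{2j+1}-\frac14\sum_{k=1}^{\frac n2}\sum_{j=0}^{2k-2}\frac{(-1)^j(8k^2-4k+1)}{k^2(2j+1)(2k-1)^2}\\&+\left(1+\frac12\sum_{j=1}^{\frac n2}\frac{1}{(2j-1)^2}-\tfrac14\ln^2 2\right)\pi-\frac{\pi^3}{8}-G\sum_{j=1}^{\frac n2}\frac{1}{j(2j-1)}+4\,\Im\,\mathrm{Li}_3(1+i).\end{aligned}$$ -/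

import Mathlib

/-- The polylogarithm `Li_n` of natural order, on its principal branch: `Li_0 z = z / (1 - z)` and
`Li_{n+1} z = ∫_0^z Li_n(w) / w dw` along the segment from `0` to `z`, parametrized as `w = t z`.
It is the holomorphic function on `ℂ ∖ [1, ∞)` that continues `∑ z ^ k / k ^ n` (`k ≥ 1`) from the
unit disc: see `polylog_eq_tsum` and `differentiableOn_polylog`. -/
noncomputable def polylog : ℕ → ℂ → ℂ
  | 0, z => z / (1 - z)
  | n + 1, z => ∫ t in (0 : ℝ)..1, polylog n (t * z) / t

theorem isOpen_polylogDomain : IsOpen {z : ℂ | 1 - z ∈ Complex.slitPlane} :=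
  Complex.isOpen_slitPlane.preimage (by fun_prop)

theorem mul_mem_polylogDomain {z : ℂ} (hz : 1 - z ∈ Complex.slitPlane) {t : ℝ} (h0 : 0 ≤ t)
    (h1 : t ≤ 1) : 1 - (t : ℂ) * z ∈ Complex.slitPlane := by
  have h := Complex.starConvex_one_slitPlane hz (sub_nonneg.2 h1) h0 (by ring)
  convert h using 1
  simp only [Complex.real_smul]
  push_cast
  ring

theorem polylog_zero_right (n : ℕ) : polylog n 0 = 0 := by
  induction n with
  | zero => simp [polylog]
  | succ n ih => simp [polylog, ih]

/-- On `ℂ ∖ [1, ∞)` the function `polylog n` is holomorphic. -/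
theorem differentiableOn_polylog (n : ℕ) :
    DifferentiableOn ℂ (polylog n) {z : ℂ | 1 - z ∈ Complex.slitPlane} := by
  induction n with
  | zero =>
    intro z hz
    have h : (1 - z : ℂ) ≠ 0 := Complex.slitPlane_ne_zero hz
    have : DifferentiableAt ℂ (fun z : ℂ => z / (1 - z)) z := by
      fun_prop (disch := exact h)
    exact this.differentiableWithinAt
  | succ n ih =>
    set S : Set ℂ := {z : ℂ | 1 - z ∈ Complex.slitPlane} with hS
    have hSo : IsOpen S := isOpen_polylogDomain
    have h0S : S ∈ nhds (0 : ℂ) := hSo.mem_nhds (by simp [hS])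
    set h : ℂ → ℂ := dslope (polylog n) 0 with hh
    have hd : DifferentiableOn ℂ h S := (Complex.differentiableOn_dslope h0S).2 ih
    have hd' : ContinuousOn (deriv h) S := (hd.deriv hSo).continuousOn
    have heq : polylog (n + 1) = fun z => z * ∫ t in (0 : ℝ)..1, h (t * z) := by
      funext z
      rw [polylog, ← intervalIntegral.integral_const_mul]
      refine intervalIntegral.integral_congr_ae ?_
      filter_upwards with t ht
      rw [Set.uIoc_of_le zero_le_one] at ht
      have ht0 : (t : ℂ) ≠ 0 := by exact_mod_cast ht.1.ne'
      have := sub_smul_dslope (polylog n) 0 ((t : ℂ) * z)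
      rw [polylog_zero_right, sub_zero, sub_zero, smul_eq_mul] at this
      rw [← this, hh]
      field_simp
    rw [heq]
    intro z hz
    refine DifferentiableAt.differentiableWithinAt ?_
    refine differentiableAt_id.mul ?_
    obtain ⟨r, hr, hrS⟩ := Metric.nhds_basis_closedBall.mem_iff.1 (hSo.mem_nhds hz)
    have hmaps : ∀ t ∈ Set.Icc (0 : ℝ) 1, ∀ w ∈ Metric.closedBall z r, (t : ℂ) * w ∈ S :=
      fun t ht w hw => mul_mem_polylogDomain (hrS hw) ht.1 ht.2
    have hcomp : IsCompact ((fun p : ℝ × ℂ => (p.1 : ℂ) * p.2) ''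
        (Set.Icc (0 : ℝ) 1 ×ˢ Metric.closedBall z r)) :=
      (isCompact_Icc.prod (isCompact_closedBall z r)).image (by fun_prop)
    have hsub : ((fun p : ℝ × ℂ => (p.1 : ℂ) * p.2) ''
        (Set.Icc (0 : ℝ) 1 ×ˢ Metric.closedBall z r)) ⊆ S := by
      rintro _ ⟨p, hp, rfl⟩
      exact hmaps p.1 hp.1 p.2 hp.2
    obtain ⟨C, hC⟩ := hcomp.exists_bound_of_continuousOn (hd'.mono hsub)
    have hcont : ∀ w ∈ Metric.closedBall z r,
        ContinuousOn (fun t : ℝ => h (t * w)) (Set.Icc 0 1) := fun w hw =>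
      hd.continuousOn.comp (by fun_prop) (fun t ht => hmaps t ht w hw)
    have hcont' : ContinuousOn (fun t : ℝ => (t : ℂ) * deriv h (t * z)) (Set.Icc 0 1) :=
      ContinuousOn.mul (by fun_prop) (hd'.comp (by fun_prop)
        (fun t ht => hmaps t ht z (Metric.mem_closedBall_self hr.le)))
    have hI : Set.uIoc (0 : ℝ) 1 = Set.Ioc 0 1 := Set.uIoc_of_le zero_le_one
    refine (intervalIntegral.hasDerivAt_integral_of_dominated_loc_of_deriv_le
      (F := fun w t => h ((t : ℂ) * w)) (F' := fun w t => (t : ℂ) * deriv h (t * w))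
      (bound := fun _ => C) (Metric.closedBall_mem_nhds z hr) ?_ ?_ ?_ ?_ ?_ ?_).2.differentiableAt
    · filter_upwards [Metric.closedBall_mem_nhds z hr] with w hw
      rw [hI]
      exact ((hcont w hw).mono Set.Ioc_subset_Icc_self).aestronglyMeasurable measurableSet_Ioc
    · exact ((hcont z (Metric.mem_closedBall_self hr.le)).mono
        (by rw [Set.uIcc_of_le zero_le_one])).intervalIntegrable
    · rw [hI]
      exact (hcont'.mono Set.Ioc_subset_Icc_self).aestronglyMeasurable measurableSet_Ioc
    · filter_upwards with t ht w hw
      rw [hI] at ht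
      have h1 := hC _ ⟨(t, w), ⟨⟨ht.1.le, ht.2⟩, hw⟩, rfl⟩
      rw [norm_mul, Complex.norm_real, Real.norm_eq_abs, abs_of_pos ht.1]
      exact (mul_le_of_le_one_left (norm_nonneg _) ht.2).trans h1
    · exact intervalIntegrable_const
    · filter_upwards with t ht w hw
      rw [hI] at ht
      have h1 := (hd.differentiableAt (hSo.mem_nhds (hmaps t ⟨ht.1.le, ht.2⟩ w hw))).hasDerivAt
      have h2 : HasDerivAt (fun w : ℂ => (t : ℂ) * w) (t : ℂ) w := by
        simpa using (hasDerivAt_id w).const_mul (t : ℂ)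
      have h3 := h1.comp w h2
      rw [mul_comm] at h3
      exact h3

/-- In the open unit disc, `polylog n z = ∑ z ^ k / k ^ n`, the sum being over `k ≥ 1`. -/
theorem polylog_eq_tsum (n : ℕ) {z : ℂ} (hz : ‖z‖ < 1) :
    polylog n z = ∑' k : ℕ, z ^ (k + 1) / ((k : ℂ) + 1) ^ n := by
  refine (HasSum.tsum_eq ?_).symm
  induction n generalizing z with
  | zero =>
    have := (hasSum_geometric_of_norm_lt_one hz).mul_left z
    simpa [polylog, pow_succ', div_eq_mul_inv] using this
  | succ n ih =>
    let f : ℕ → C(ℝ, ℂ) := fun k =>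
      ⟨fun t => (t : ℂ) ^ k * (z ^ (k + 1) / ((k : ℂ) + 1) ^ n), by fun_prop⟩
    have hk1 : ∀ k : ℕ, (k : ℂ) + 1 ≠ 0 := fun k => Nat.cast_add_one_ne_zero k
    have hb : Summable fun k : ℕ => ‖(f k).restrict
        (⟨Set.uIcc (0 : ℝ) 1, isCompact_uIcc⟩ : TopologicalSpace.Compacts ℝ)‖ := by
      refine Summable.of_nonneg_of_le (fun _ => norm_nonneg _) (fun k => ?_)
        (summable_geometric_of_lt_one (norm_nonneg z) hz)
      refine (ContinuousMap.norm_le _ (by positivity)).2 ?_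
      rintro ⟨t, ht⟩
      have ht : t ∈ Set.uIcc (0 : ℝ) 1 := ht
      rw [Set.uIcc_of_le zero_le_one] at ht
      simp only [f, ContinuousMap.restrict_apply, ContinuousMap.coe_mk, norm_mul, norm_pow,
        norm_div, Complex.norm_real, Real.norm_eq_abs, abs_of_nonneg ht.1]
      have h1 : (1 : ℝ) ≤ ‖(k : ℂ) + 1‖ ^ n := by
        refine one_le_pow₀ ?_
        rw [← Nat.cast_add_one, Complex.norm_natCast]
        simp
      calc t ^ k * (‖z‖ ^ (k + 1) / ‖(k : ℂ) + 1‖ ^ n)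
          ≤ 1 * (‖z‖ ^ (k + 1)) := by
            refine mul_le_mul (pow_le_one₀ ht.1 ht.2) (div_le_self (by positivity) h1)
              (by positivity) zero_le_one
        _ ≤ ‖z‖ ^ k := by
            rw [one_mul]; exact pow_le_pow_of_le_one (norm_nonneg _) hz.le (Nat.le_succ k)
    have := intervalIntegral.hasSum_intervalIntegral_of_summable_norm (f := f) (a := 0) (b := 1) hb
    have e1 : (fun k : ℕ => z ^ (k + 1) / ((k : ℂ) + 1) ^ (n + 1)) =
        fun k : ℕ => ∫ t in (0 : ℝ)..1, f k t := by
      funext k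
      simp only [f, ContinuousMap.coe_mk]
      rw [intervalIntegral.integral_mul_const]
      have : ∫ t in (0 : ℝ)..1, (t : ℂ) ^ k = 1 / ((k : ℂ) + 1) := by
        have h : ∫ t in (0 : ℝ)..1, t ^ k = 1 / ((k : ℝ) + 1) := by simp
        have h2 := congrArg (fun x : ℝ => (x : ℂ)) h
        simp only [← intervalIntegral.integral_ofReal] at h2
        push_cast at h2
        exact h2
      rw [this, pow_succ]
      field_simp [hk1 k]
      ring
    have e2 : polylog (n + 1) z = ∫ t in (0 : ℝ)..1, ∑' k : ℕ, f k t := by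
      rw [polylog]
      refine intervalIntegral.integral_congr_ae ?_
      filter_upwards with t ht
      rw [Set.uIoc_of_le zero_le_one] at ht
      have ht0 : (t : ℂ) ≠ 0 := by exact_mod_cast ht.1.ne'
      have htz : ‖(t : ℂ) * z‖ < 1 := by
        rw [norm_mul, Complex.norm_real, Real.norm_eq_abs, abs_of_pos ht.1]
        exact (mul_le_of_le_one_left (norm_nonneg _) ht.2).trans_lt hz
      rw [div_eq_iff ht0, ← (ih htz).tsum_eq, ← tsum_mul_right]
      refine tsum_congr fun k => ?_
      simp only [f, ContinuousMap.coe_mk]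
      ring
    rw [e1, e2]
    exact this

/-- Catalan's constant `G = ∑ (-1) ^ k / (2 k + 1) ^ 2`, the sum being over `k ≥ 0`. -/
noncomputable def catalanConst : ℝ := ∑' k : ℕ, (-1 : ℝ) ^ k / (2 * (k : ℝ) + 1) ^ 2

/-- The `k`-th term of the alternating digamma series `Θ₂(n, α)`, `k ≥ 1`. -/
noncomputable def thetaTwoTerm (n α k : ℕ) : ℂ :=
  (-1) ^ k * (Complex.digamma ((2 * k + 2 * n + 5) / 4) -
    Complex.digamma ((2 * k + 2 * n + 3) / 4)) / (2 * k + α) ^ 2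

/-- The sum from `k = 1` to `∞` of the series `Θ₂(n, α)` converges and has the value `s`. -/
def ThetaTwoHasSum (n α : ℕ) (s : ℝ) : Prop :=
  HasSum (fun k : ℕ => thetaTwoTerm n α (k + 1)) (s : ℂ)

/-!
# The alternating digamma series `Θ₂(n, 1)`

The sequences `m ↦ ψ((2 m + 3) / 4) - ψ((2 m + 1) / 4)` and
`m ↦ J(m) = 4 ∫₀¹ x ^ (2 m) / (1 + x ^ 2) dx` satisfy the same recurrence
`f m + f (m + 1) = 4 / (2 m + 1)`, and both tend to `0` (the first because `ψ` is monotone, by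
log-convexity of `Γ`), so they agree (`digamma_sub_digamma`). Hence the terms of `Θ₂(n, 1)` are
`(-1) ^ k * J(k + n + 1) / (2 k + 1) ^ 2`, which is absolutely summable.

For `n = 0`, summing under the integral sign gives `4 ∫₀¹ x (Ti₂ x - x) / (1 + x ^ 2) dx` with the
inverse tangent integral `Ti₂ x = -Im Li₂(-i x)`. Integration by parts leaves the integral of
`ln (1 + x ^ 2) arctan x / x = Im (log (1 + i x) ^ 2) / x`, and with `w = 1 + i x` an antiderivative
of `log (w) ^ 2 / x` is `log (1 - w) log (w) ^ 2 + 2 log (w) Li₂ w - 2 Li₃ w`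
(`hasDerivAt_thetaPrimitive`). Its imaginary part vanishes as `x → 0`
(`tendsto_thetaPrimitive_zero`); its value at `x = 1` involves `Im Li₃(1 + i)` and `Li₂(1 + i)`, and
the latter comes from Euler's reflection formula (`polylog_two_reflection`) and the series of
`Li₂(-i)`.

For the other `n`, the recurrence of `J` turns `Θ₂(n, 1) + Θ₂(n + 1, 1)` into a series of rational
terms, summed by partial fractions, Catalan's series and Leibniz's series
(`hasSum_thetaTwoRealTerm_succ`). Applied twice, this proves the closed forms for even and for odd
`n` by induction (`hasSum_theta_even`, `hasSum_theta_odd`).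
-/

/-! ### A digamma difference as an integral -/

/-- The integral `4 ∫₀¹ x ^ (2 m) / (1 + x ^ 2) dx`, which is the digamma difference
`ψ((2 m + 3) / 4) - ψ((2 m + 1) / 4)`. -/
noncomputable def arctanMoment (m : ℕ) : ℝ := ∫ x in (0 : ℝ)..1, 4 * x ^ (2 * m) / (1 + x ^ 2)

theorem continuous_arctanMoment_integrand (m : ℕ) :
    Continuous fun x : ℝ => 4 * x ^ (2 * m) / (1 + x ^ 2) :=
  Continuous.div (by fun_prop) (by fun_prop) fun x => (by positivity : (0 : ℝ) < 1 + x ^ 2).ne'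

theorem arctanMoment_nonneg (m : ℕ) : 0 ≤ arctanMoment m :=
  intervalIntegral.integral_nonneg zero_le_one fun x hx => by
    have := hx.1
    positivity

theorem arctanMoment_add_succ (m : ℕ) :
    arctanMoment m + arctanMoment (m + 1) = 4 / (2 * m + 1) := by
  rw [arctanMoment, arctanMoment, ← intervalIntegral.integral_add
    ((continuous_arctanMoment_integrand m).intervalIntegrable _ _)
    ((continuous_arctanMoment_integrand (m + 1)).intervalIntegrable _ _)]
  have h : ∀ x : ℝ, 4 * x ^ (2 * m) / (1 + x ^ 2) + 4 * x ^ (2 * (m + 1)) / (1 + x ^ 2)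
      = 4 * x ^ (2 * m) := fun x => by
    have : (1 + x ^ 2 : ℝ) ≠ 0 := by positivity
    field_simp
    ring
  simp only [h, intervalIntegral.integral_const_mul, integral_pow]
  push_cast
  simp
  ring

theorem arctanMoment_zero : arctanMoment 0 = Real.pi := by
  have h : ∀ x : ℝ, 4 * x ^ (2 * 0) / (1 + x ^ 2) = 4 * (1 / (1 + x ^ 2)) := fun x => by ring
  simp only [arctanMoment, h, intervalIntegral.integral_const_mul, integral_one_div_one_add_sq,
    Real.arctan_one, Real.arctan_zero]
  ring

theorem arctanMoment_le (m : ℕ) : arctanMoment m ≤ 4 / (2 * m + 1) := by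
  linarith [arctanMoment_add_succ m, arctanMoment_nonneg (m + 1)]

theorem digamma_ofReal {x : ℝ} (hx : 0 < x) :
    Complex.digamma x = (deriv (Real.log ∘ Real.Gamma) x : ℝ) := by
  have hx' : ∀ m : ℕ, x ≠ -m := fun m h => by
    have : (0 : ℝ) ≤ m := m.cast_nonneg
    linarith
  have hd : DifferentiableAt ℝ Real.Gamma x := Real.differentiableAt_Gamma hx'
  have h1 : HasDerivAt (fun y : ℝ => Complex.Gamma y) (deriv Complex.Gamma x) x :=
    (Complex.differentiableAt_Gamma x fun m h => hx' m (by exact_mod_cast h)).hasDerivAt.comp_ofReal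
  have h2 := hd.hasDerivAt.ofReal_comp
  simp only [Complex.Gamma_ofReal] at h1
  have h3 : deriv (Real.log ∘ Real.Gamma) x = deriv Real.Gamma x / Real.Gamma x :=
    (hd.hasDerivAt.log (Real.Gamma_pos_of_pos hx).ne').deriv
  rw [Complex.digamma_def, logDeriv_apply, h1.unique h2, Complex.Gamma_ofReal, h3]
  push_cast
  rfl

/-- The digamma function increases on `(0, ∞)` by log-convexity of `Γ`, and it grows by `1 / x` from
`x` to `x + 1`. -/
theorem digamma_sub_bounds {x : ℝ} (hx : 0 < x) : ∃ d : ℝ, 0 ≤ d ∧ d ≤ 1 / x ∧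
    Complex.digamma ((x + 1 / 2 : ℝ) : ℂ) - Complex.digamma x = d := by
  set ψ : ℝ → ℝ := deriv (Real.log ∘ Real.Gamma) with hψ
  have hmono : MonotoneOn ψ (Set.Ioi 0) := by
    refine Real.convexOn_log_Gamma.monotoneOn_deriv fun y hy => ?_
    have hy : 0 < y := hy
    refine DifferentiableAt.comp y (Real.differentiableAt_log (Real.Gamma_pos_of_pos hy).ne')
      (Real.differentiableAt_Gamma fun m h => ?_)
    have : (0 : ℝ) ≤ m := m.cast_nonneg
    linarith
  have hstep : ψ (x + 1) = ψ x + 1 / x := by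
    have h := Complex.digamma_apply_add_one (x : ℂ) fun m h => by
      have h' : x = -(m : ℝ) := by exact_mod_cast h
      have : (0 : ℝ) ≤ m := m.cast_nonneg
      linarith
    have e : (x : ℂ) + 1 = ((x + 1 : ℝ) : ℂ) := by push_cast; rfl
    rw [e, digamma_ofReal hx, digamma_ofReal (by linarith)] at h
    have h' : ((ψ (x + 1) : ℝ) : ℂ) = ((ψ x + 1 / x : ℝ) : ℂ) := by
      push_cast
      simpa using h
    exact_mod_cast h'
  have h1 : ψ x ≤ ψ (x + 1 / 2) :=
    hmono hx (show 0 < x + 1 / 2 by linarith) (by linarith)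
  have h2 : ψ (x + 1 / 2) ≤ ψ (x + 1) :=
    hmono (show 0 < x + 1 / 2 by linarith) (show 0 < x + 1 by linarith) (by linarith)
  refine ⟨ψ (x + 1 / 2) - ψ x, by linarith, by linarith, ?_⟩
  rw [digamma_ofReal hx, digamma_ofReal (by linarith : 0 < x + 1 / 2)]
  push_cast
  rfl

/-- Both sides satisfy `f m + f (m + 1) = 4 / (2 m + 1)` and tend to `0`, and these two properties
determine a sequence. -/
theorem digamma_sub_digamma (m : ℕ) :
    Complex.digamma ((2 * m + 3) / 4) - Complex.digamma ((2 * m + 1) / 4) = arctanMoment m := by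
  have key : ∀ m : ℕ, ∃ d : ℝ, 0 ≤ d ∧ d ≤ 4 / (2 * m + 1) ∧
      Complex.digamma ((2 * m + 3) / 4) - Complex.digamma ((2 * m + 1) / 4) = d := fun m => by
    obtain ⟨d, h0, h1, h2⟩ := digamma_sub_bounds (x := (2 * m + 1) / 4) (by positivity)
    refine ⟨d, h0, h1.trans_eq (one_div_div _ _), ?_⟩
    rw [← h2]
    congr 2 <;> push_cast <;> ring
  choose d hd0 hd1 hd using key
  have hrec : ∀ m, d m + d (m + 1) = 4 / (2 * m + 1) := fun m => by
    have h := Complex.digamma_apply_add_one ((2 * m + 1) / 4 : ℂ) fun k h => by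
      have h' : ((2 * m + 1) / 4 : ℝ) = -(k : ℝ) := by
        simpa using congrArg Complex.re h
      have : (0 : ℝ) ≤ k := k.cast_nonneg
      have : (0 : ℝ) < (2 * m + 1) / 4 := by positivity
      linarith
    have e : ((d m + d (m + 1) : ℝ) : ℂ) = ((4 / (2 * m + 1) : ℝ) : ℂ) := by
      push_cast
      rw [← hd, ← hd]
      have e1 : ((2 * ((m + 1 : ℕ) : ℂ) + 3) / 4) = (2 * m + 1) / 4 + 1 := by push_cast; ring
      have e2 : ((2 * ((m + 1 : ℕ) : ℂ) + 1) / 4) = (2 * m + 3) / 4 := by push_cast; ring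
      rw [e1, e2, h]
      simp
    exact_mod_cast e
  -- The difference of two solutions of the recurrence has constant absolute value.
  have hconst : ∀ N, |d m - arctanMoment m| = |d (m + N) - arctanMoment (m + N)| := by
    intro N
    induction N with
    | zero => rfl
    | succ N ih =>
      have : d (m + N) - arctanMoment (m + N)
          = -(d (m + (N + 1)) - arctanMoment (m + (N + 1))) := by
        have h1 := hrec (m + N)
        have h2 := arctanMoment_add_succ (m + N)
        rw [← add_assoc]
        linarith
      rw [ih, this, abs_neg]
  have hlim : Filter.Tendsto (fun N : ℕ => 4 / ((N : ℝ) + 1)) Filter.atTop (nhds 0) := by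
    simpa [div_eq_mul_inv] using
      (tendsto_one_div_add_atTop_nhds_zero_nat (𝕜 := ℝ)).const_mul 4
  have hle : |d m - arctanMoment m| ≤ 0 := by
    refine ge_of_tendsto' hlim fun N => ?_
    rw [hconst N]
    have hb : (4 : ℝ) / (2 * ((m + N : ℕ) : ℝ) + 1) ≤ 4 / ((N : ℝ) + 1) := by
      have : (0 : ℝ) ≤ m := m.cast_nonneg
      have : (0 : ℝ) ≤ N := N.cast_nonneg
      push_cast
      gcongr
      linarith
    exact (abs_sub_le_of_nonneg_of_le (hd0 _) (hd1 _) (arctanMoment_nonneg _)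
      (arctanMoment_le _)).trans hb
  rw [hd, sub_eq_zero.1 (abs_nonpos_iff.1 hle)]

/-- The term of index `k + 1` of the series `Θ₂(n, 1)`, in real form. -/
noncomputable def thetaTwoRealTerm (n k : ℕ) : ℝ :=
  (-1) ^ (k + 1) * arctanMoment (k + n + 2) / (2 * k + 3) ^ 2

theorem thetaTwoTerm_one_succ (n k : ℕ) :
    thetaTwoTerm n 1 (k + 1) = (thetaTwoRealTerm n k : ℂ) := by
  have h := digamma_sub_digamma (k + n + 2)
  have e1 : (2 * ((k + n + 2 : ℕ) : ℂ) + 3) / 4 = (2 * ((k + 1 : ℕ) : ℂ) + 2 * n + 5) / 4 := by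
    push_cast; ring
  have e2 : (2 * ((k + n + 2 : ℕ) : ℂ) + 1) / 4 = (2 * ((k + 1 : ℕ) : ℂ) + 2 * n + 3) / 4 := by
    push_cast; ring
  have e3 : 2 * ((k + 1 : ℕ) : ℂ) + ((1 : ℕ) : ℂ) = 2 * k + 3 := by push_cast; ring
  rw [e1, e2] at h
  rw [thetaTwoTerm, h, e3, thetaTwoRealTerm]
  push_cast
  rfl

/-! ### Derivatives and boundary values of the polylogarithm -/

theorem polylog_one {z : ℂ} (hz : 1 - z ∈ Complex.slitPlane) :
    polylog 1 z = -Complex.log (1 - z) := by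
  have hd : ∀ t ∈ Set.uIcc (0 : ℝ) 1, HasDerivAt (fun t : ℝ => -Complex.log (1 - t * z))
      (z / (1 - t * z)) t := fun t ht => by
    rw [Set.uIcc_of_le zero_le_one] at ht
    have h1 : HasDerivAt (fun t : ℝ => 1 - (t : ℂ) * z) (-z) t := by
      simpa using ((hasDerivAt_id (t : ℂ)).mul_const z).comp_ofReal.const_sub 1
    have h2 := (h1.clog_real (mul_mem_polylogDomain hz ht.1 ht.2)).neg
    exact h2.congr_deriv (by rw [neg_div, neg_neg])
  have hc : ContinuousOn (fun t : ℝ => z / (1 - t * z)) (Set.uIcc (0 : ℝ) 1) := by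
    refine ContinuousOn.div (by fun_prop) (by fun_prop) fun t ht => ?_
    rw [Set.uIcc_of_le zero_le_one] at ht
    exact Complex.slitPlane_ne_zero (mul_mem_polylogDomain hz ht.1 ht.2)
  have h := intervalIntegral.integral_eq_sub_of_hasDerivAt hd hc.intervalIntegrable
  have e : polylog 1 z = ∫ t in (0 : ℝ)..1, z / (1 - t * z) := by
    rw [polylog]
    refine intervalIntegral.integral_congr_ae ?_
    filter_upwards with t ht
    rw [Set.uIoc_of_le zero_le_one] at ht
    have ht0 : (t : ℂ) ≠ 0 := by exact_mod_cast ht.1.ne'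
    rw [polylog]
    field_simp
  rw [e, h]
  simp

theorem differentiableAt_polylog (n : ℕ) {z : ℂ} (hz : 1 - z ∈ Complex.slitPlane) :
    DifferentiableAt ℂ (polylog n) z :=
  (differentiableOn_polylog n).differentiableAt (isOpen_polylogDomain.mem_nhds hz)

/-- Since `polylog n 0 = 0`, the integrand extends continuously to `t = 0` by a slope of
`polylog n`. -/
theorem intervalIntegrable_polylog_div (n : ℕ) {z : ℂ} (hz : 1 - z ∈ Complex.slitPlane) :
    IntervalIntegrable (fun t : ℝ => polylog n (t * z) / t) MeasureTheory.volume 0 1 := by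
  have h0 : {z : ℂ | 1 - z ∈ Complex.slitPlane} ∈ nhds (0 : ℂ) :=
    isOpen_polylogDomain.mem_nhds (by simp)
  have hd := (Complex.differentiableOn_dslope h0).2 (differentiableOn_polylog n)
  have hc : ContinuousOn (fun t : ℝ => z * dslope (polylog n) 0 (t * z)) (Set.uIcc 0 1) := by
    refine ContinuousOn.mul continuousOn_const (hd.continuousOn.comp (by fun_prop) fun t ht => ?_)
    rw [Set.uIcc_of_le zero_le_one] at ht
    exact mul_mem_polylogDomain hz ht.1 ht.2
  refine hc.intervalIntegrable.congr fun t ht => ?_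
  rw [Set.uIoc_of_le zero_le_one] at ht
  have ht0 : (t : ℂ) ≠ 0 := by exact_mod_cast ht.1.ne'
  have := sub_smul_dslope (polylog n) 0 ((t : ℂ) * z)
  rw [polylog_zero_right, sub_zero, sub_zero, smul_eq_mul] at this
  simp only [← this]
  field_simp

/-- The rule `z Li_{n+1}'(z) = Li_n(z)`: since the complex derivative exists, it suffices to
differentiate along the ray through `z`. -/
theorem hasDerivAt_polylog_succ (n : ℕ) {z : ℂ} (hz : 1 - z ∈ Complex.slitPlane) (hz0 : z ≠ 0) :
    HasDerivAt (polylog (n + 1)) (polylog n z / z) z := by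
  have hd := (differentiableAt_polylog (n + 1) hz).hasDerivAt
  have hray : HasDerivAt (fun s : ℝ => polylog (n + 1) (s * z))
      (deriv (polylog (n + 1)) z * z) 1 := by
    have h1 : HasDerivAt (fun s : ℂ => s * z) z ((1 : ℝ) : ℂ) := by
      simpa using (hasDerivAt_id ((1 : ℝ) : ℂ)).mul_const z
    refine HasDerivAt.comp_ofReal (e := fun s : ℂ => polylog (n + 1) (s * z)) ?_
    have h2 : HasDerivAt (polylog (n + 1)) (deriv (polylog (n + 1)) z) (((1 : ℝ) : ℂ) * z) := by
      simpa using hd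
    exact h2.comp ((1 : ℝ) : ℂ) h1
  have hcont : ContinuousAt (fun t : ℝ => polylog n (t * z) / t) 1 := by
    refine ContinuousAt.div ?_ (by fun_prop) (by simp)
    refine ContinuousAt.comp (g := polylog n) (f := fun t : ℝ => (t : ℂ) * z) ?_ (by fun_prop)
    simpa using (differentiableAt_polylog n hz).continuousAt
  have hmeas : StronglyMeasurableAtFilter (fun t : ℝ => polylog n (t * z) / t) (nhds 1)
      MeasureTheory.volume := by
    have hopen : IsOpen {t : ℝ | 0 < t ∧ 1 - (t : ℂ) * z ∈ Complex.slitPlane} :=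
      (isOpen_lt continuous_const continuous_id).inter
        (Complex.isOpen_slitPlane.preimage (by fun_prop))
    refine ContinuousOn.stronglyMeasurableAtFilter hopen (fun t ht => ?_) 1 ⟨one_pos, by simpa⟩
    have ht0 : (t : ℂ) ≠ 0 := by exact_mod_cast ht.1.ne'
    refine ContinuousAt.continuousWithinAt (ContinuousAt.div ?_ (by fun_prop) ht0)
    exact ContinuousAt.comp (g := polylog n) (f := fun t : ℝ => (t : ℂ) * z)
      (differentiableAt_polylog n ht.2).continuousAt (by fun_prop)
  have hint := intervalIntegral.integral_hasDerivAt_right (intervalIntegrable_polylog_div n hz)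
    hmeas hcont
  have heq : (fun s : ℝ => polylog (n + 1) (s * z)) =ᶠ[nhds 1]
      fun s => ∫ t in (0 : ℝ)..s, polylog n (t * z) / t := by
    filter_upwards [lt_mem_nhds (zero_lt_one' ℝ)] with s hs
    have hs0 : (s : ℂ) ≠ 0 := by exact_mod_cast hs.ne'
    have h := intervalIntegral.smul_integral_comp_mul_right (a := 0) (b := 1)
      (fun t : ℝ => polylog n (t * z) / t) s
    rw [zero_mul, one_mul] at h
    rw [← h, polylog, ← intervalIntegral.integral_smul]
    congr 1
    funext t
    push_cast
    rw [Complex.real_smul, mul_assoc, ← mul_div_assoc, mul_comm (t : ℂ) (s : ℂ),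
      mul_div_mul_left _ _ hs0]
  have h := hray.unique (hint.congr_of_eventuallyEq heq)
  simp only [Complex.ofReal_one, one_mul, div_one] at h
  rw [← h, mul_div_assoc, div_self hz0, mul_one]
  exact hd

theorem polylog_ofReal_im (n : ℕ) (x : ℝ) : (polylog n x).im = 0 := by
  have key : ∀ x : ℝ, polylog n x = ((polylog n x).re : ℂ) := by
    induction n with
    | zero =>
      intro x
      have : polylog 0 (x : ℂ) = ((x / (1 - x) : ℝ) : ℂ) := by rw [polylog]; push_cast; rfl
      rw [this, Complex.ofReal_re]
    | succ n ih =>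
      intro x
      have : polylog (n + 1) (x : ℂ)
          = ((∫ t in (0 : ℝ)..1, (polylog n ((t * x : ℝ) : ℂ)).re / t : ℝ) : ℂ) := by
        rw [polylog, ← intervalIntegral.integral_ofReal]
        congr 1
        funext t
        rw [Complex.ofReal_div, ← ih, Complex.ofReal_mul]
      rw [this, Complex.ofReal_re]
  rw [key x, Complex.ofReal_im]

/-! ### The dilogarithm and trilogarithm near `1` -/

/-- Abel's theorem for the dilogarithm: its series converges absolutely on the closed disc. -/
theorem tendsto_polylog_two_mul {z : ℂ} (hz : ‖z‖ ≤ 1) :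
    Filter.Tendsto (fun r : ℝ => polylog 2 (r * z)) (nhdsWithin 1 (Set.Iio 1))
      (nhds (∑' k : ℕ, z ^ (k + 1) / ((k : ℂ) + 1) ^ 2)) := by
  have hsum : Summable fun k : ℕ => 1 / ((k : ℝ) + 1) ^ 2 := by
    exact_mod_cast (summable_nat_add_iff 1).2 (Real.summable_one_div_nat_pow.2 one_lt_two)
  have hev : ∀ᶠ r : ℝ in nhdsWithin 1 (Set.Iio 1), 0 < r ∧ r < 1 := by
    filter_upwards [self_mem_nhdsWithin,
      nhdsWithin_le_nhds (lt_mem_nhds (zero_lt_one' ℝ))] with r h1 h2 using ⟨h2, h1⟩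
  have hnorm : ∀ r : ℝ, 0 < r → ‖(r : ℂ) * z‖ ≤ r := fun r hr => by
    rw [norm_mul, Complex.norm_real, Real.norm_of_nonneg hr.le]
    exact mul_le_of_le_one_right hr.le hz
  have hlim : Filter.Tendsto (fun r : ℝ => ∑' k : ℕ, ((r : ℂ) * z) ^ (k + 1) / ((k : ℂ) + 1) ^ 2)
      (nhdsWithin 1 (Set.Iio 1)) (nhds (∑' k : ℕ, z ^ (k + 1) / ((k : ℂ) + 1) ^ 2)) := by
    refine tendsto_tsum_of_dominated_convergence hsum (fun k => ?_) ?_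
    · have : Continuous fun r : ℝ => ((r : ℂ) * z) ^ (k + 1) / ((k : ℂ) + 1) ^ 2 := by fun_prop
      simpa using (this.tendsto 1).mono_left nhdsWithin_le_nhds
    · filter_upwards [hev] with r hr k
      rw [norm_div, norm_pow, norm_pow]
      have h1 : ‖(k : ℂ) + 1‖ = (k : ℝ) + 1 := by
        rw [← Nat.cast_add_one, Complex.norm_natCast]; push_cast; rfl
      rw [h1]
      gcongr
      exact pow_le_one₀ (norm_nonneg _) ((hnorm r hr.1).trans hr.2.le)
  refine hlim.congr' ?_
  filter_upwards [hev] with r hr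
  exact (polylog_eq_tsum 2 ((hnorm r hr.1).trans_lt hr.2)).symm

theorem polylog_two_eq_tsum {z : ℂ} (hz : ‖z‖ ≤ 1) (hz' : 1 - z ∈ Complex.slitPlane) :
    polylog 2 z = ∑' k : ℕ, z ^ (k + 1) / ((k : ℂ) + 1) ^ 2 := by
  refine tendsto_nhds_unique ?_ (tendsto_polylog_two_mul hz)
  have : ContinuousAt (fun r : ℝ => polylog 2 (r * z)) 1 := by
    refine ContinuousAt.comp (g := polylog 2) (f := fun t : ℝ => (t : ℂ) * z) ?_ (by fun_prop)
    simpa using (differentiableAt_polylog 2 hz').continuousAt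
  simpa using this.tendsto.mono_left nhdsWithin_le_nhds

theorem tendsto_polylog_two_one :
    Filter.Tendsto (fun r : ℝ => polylog 2 r) (nhdsWithin 1 (Set.Iio 1))
      (nhds ((Real.pi : ℂ) ^ 2 / 6)) := by
  have h := tendsto_polylog_two_mul (z := 1) (by simp)
  have hs : HasSum (fun k : ℕ => (1 : ℝ) / ((k : ℝ) + 1) ^ 2) (Real.pi ^ 2 / 6) := by
    have := (hasSum_nat_add_iff' 1).2 hasSum_zeta_two
    simpa using this
  have hs' := (Complex.hasSum_ofReal.2 hs).tsum_eq
  push_cast at hs'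
  simp only [one_pow] at h
  rw [hs'] at h
  simpa using h

/-- Near `1`, `log w = O(w - 1)` while `log (1 - w)` is of the size of `ln |w - 1|`. -/
theorem tendsto_log_mul_log_one_sub :
    Filter.Tendsto (fun w : ℂ => Complex.log w * Complex.log (1 - w)) (nhdsWithin 1 {1}ᶜ)
      (nhds 0) := by
  have hO : (fun w : ℂ => Complex.log w) =O[nhds 1] fun w => w - 1 := by
    simpa using (Complex.hasDerivAt_log (Complex.one_mem_slitPlane)).isBigO_sub
  obtain ⟨C, hC⟩ := hO.bound
  have hx : Filter.Tendsto (fun w : ℂ => ‖w - 1‖) (nhdsWithin 1 {1}ᶜ)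
      (nhdsWithin 0 (Set.Ioi 0)) := by
    refine tendsto_nhdsWithin_iff.2 ⟨?_, ?_⟩
    · have : Continuous fun w : ℂ => ‖w - 1‖ := by fun_prop
      simpa using (this.tendsto 1).mono_left nhdsWithin_le_nhds
    · filter_upwards [self_mem_nhdsWithin] with w hw
      exact norm_pos_iff.2 (sub_ne_zero.2 hw)
  have hr : Filter.Tendsto (fun x : ℝ => C * (|Real.log x * x| + x * Real.pi))
      (nhdsWithin 0 (Set.Ioi 0)) (nhds 0) := by
    have h1 : Filter.Tendsto (fun x : ℝ => |Real.log x * x|) (nhdsWithin 0 (Set.Ioi 0))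
        (nhds 0) := by
      simpa only [Real.rpow_one, abs_zero] using (tendsto_log_mul_rpow_nhdsGT_zero one_pos).abs
    have h2 : Filter.Tendsto (fun x : ℝ => x * Real.pi) (nhdsWithin 0 (Set.Ioi 0)) (nhds 0) := by
      have : Continuous fun x : ℝ => x * Real.pi := by fun_prop
      simpa using (this.tendsto 0).mono_left nhdsWithin_le_nhds
    simpa using (h1.add h2).const_mul C
  refine squeeze_zero_norm' ?_ (hr.comp hx)
  filter_upwards [nhdsWithin_le_nhds hC] with w hw
  have h1 : ‖Complex.log (1 - w)‖ ≤ |Real.log ‖w - 1‖| + Real.pi := by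
    refine (Complex.norm_le_abs_re_add_abs_im _).trans ?_
    rw [Complex.log_re, Complex.log_im, norm_sub_rev]
    gcongr
    exact Complex.abs_arg_le_pi _
  have h2 : |Real.log ‖w - 1‖ * ‖w - 1‖| = |Real.log ‖w - 1‖| * ‖w - 1‖ := by
    rw [abs_mul, abs_norm]
  rw [norm_mul, Function.comp_apply, h2]
  calc _ ≤ (C * ‖w - 1‖) * (|Real.log ‖w - 1‖| + Real.pi) := by
        gcongr
        exact (norm_nonneg _).trans hw
    _ = _ := by ring

/-- Euler's reflection formula for the dilogarithm. The left side has derivative zero; its value is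
found by letting `z` tend to `1` along the reals. -/
theorem polylog_two_reflection {z : ℂ} (hz : z ∈ Complex.slitPlane)
    (hz' : 1 - z ∈ Complex.slitPlane) :
    polylog 2 z + polylog 2 (1 - z) + Complex.log z * Complex.log (1 - z) = Real.pi ^ 2 / 6 := by
  set U : Set ℂ := Complex.slitPlane ∩ {z : ℂ | 1 - z ∈ Complex.slitPlane} with hU
  set R : ℂ → ℂ := fun z => polylog 2 z + polylog 2 (1 - z) + Complex.log z * Complex.log (1 - z)
    with hR
  have hUo : IsOpen U := Complex.isOpen_slitPlane.inter isOpen_polylogDomain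
  have hUc : IsPreconnected U := by
    have h3 : StarConvex ℝ (1 / 2 : ℂ) Complex.slitPlane := by
      have := Complex.starConvex_ofReal_slitPlane (one_half_pos (α := ℝ))
      push_cast at this
      exact this
    have hstar : StarConvex ℝ (1 / 2 : ℂ) U := by
      refine h3.inter fun w hw a b ha hb hab => ?_
      have h4 := h3 hw ha hb hab
      have hab' : (a : ℂ) + b = 1 := by exact_mod_cast hab
      have e : 1 - (a • (1 / 2 : ℂ) + b • w) = a • (1 / 2 : ℂ) + b • (1 - w) := by
        simp only [Complex.real_smul]
        linear_combination (-1 : ℂ) * hab'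
      exact show 1 - (a • (1 / 2 : ℂ) + b • w) ∈ Complex.slitPlane from e ▸ h4
    exact (hstar.isPathConnected ⟨by simp [Complex.mem_slitPlane_iff], by
      simp [Complex.mem_slitPlane_iff]; norm_num⟩).isConnected.isPreconnected
  have hderiv : ∀ w ∈ U, HasDerivAt R 0 w := fun w hw => by
    obtain ⟨hw1, hw2 : 1 - w ∈ Complex.slitPlane⟩ := hw
    have hw0 := Complex.slitPlane_ne_zero hw1
    have hw0' := Complex.slitPlane_ne_zero hw2
    have hw1' : 1 - (1 - w) ∈ Complex.slitPlane := by simpa using hw1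
    have hsub : HasDerivAt (fun w : ℂ => 1 - w) (-1) w := by
      simpa using (hasDerivAt_id w).const_sub 1
    have d1 := hasDerivAt_polylog_succ 1 hw2 hw0
    have d2 := (hasDerivAt_polylog_succ 1 hw1' hw0').comp w hsub
    have d3 := (Complex.hasDerivAt_log hw1).mul (hsub.clog hw2)
    rw [polylog_one hw2] at d1
    rw [polylog_one hw1'] at d2
    refine ((d1.add d2).add d3).congr_deriv ?_
    rw [sub_sub_cancel]
    field_simp
    ring
  have hconst : ∀ r : ℝ, 0 < r → r < 1 → R r = R z := fun r h0 h1 =>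
    hUo.is_const_of_deriv_eq_zero hUc
      (fun w hw => (hderiv w hw).differentiableAt.differentiableWithinAt)
      (fun w hw => (hderiv w hw).deriv)
      ⟨Complex.ofReal_mem_slitPlane.2 h0, by
        have : ((1 - r : ℝ) : ℂ) ∈ Complex.slitPlane :=
          Complex.ofReal_mem_slitPlane.2 (sub_pos.2 h1)
        simpa using this⟩ ⟨hz, hz'⟩
  have hto : Filter.Tendsto (fun r : ℝ => (r : ℂ)) (nhdsWithin 1 (Set.Iio 1))
      (nhdsWithin 1 {1}ᶜ) := by
    refine tendsto_nhdsWithin_iff.2 ⟨?_, ?_⟩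
    · simpa using (Complex.continuous_ofReal.tendsto 1).mono_left nhdsWithin_le_nhds
    · filter_upwards [self_mem_nhdsWithin] with r hr
      have : (r : ℂ) ≠ 1 := by exact_mod_cast ne_of_lt hr
      exact this
  have hzero : Filter.Tendsto (fun r : ℝ => polylog 2 (1 - r)) (nhdsWithin 1 (Set.Iio 1))
      (nhds 0) := by
    have hc : ContinuousAt (fun r : ℝ => polylog 2 (1 - r)) 1 := by
      refine ContinuousAt.comp (g := polylog 2) (f := fun r : ℝ => 1 - (r : ℂ)) ?_ (by fun_prop)
      exact (differentiableAt_polylog 2 (by simp)).continuousAt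
    simpa [polylog_zero_right] using hc.tendsto.mono_left nhdsWithin_le_nhds
  have hlim : Filter.Tendsto (fun r : ℝ => R r) (nhdsWithin 1 (Set.Iio 1))
      (nhds ((Real.pi : ℂ) ^ 2 / 6)) := by
    simpa using (tendsto_polylog_two_one.add hzero).add (tendsto_log_mul_log_one_sub.comp hto)
  refine tendsto_nhds_unique (tendsto_const_nhds.congr' ?_) hlim
  filter_upwards [self_mem_nhdsWithin,
    nhdsWithin_le_nhds (lt_mem_nhds (zero_lt_one' ℝ))] with r h1 h0
  exact (hconst r h0 h1).symm

theorem tendsto_polylog_two_nhdsWithin_one :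
    Filter.Tendsto (polylog 2) (nhdsWithin 1 {z : ℂ | 1 - z ∈ Complex.slitPlane})
      (nhds ((Real.pi : ℂ) ^ 2 / 6)) := by
  have hle : nhdsWithin (1 : ℂ) {z : ℂ | 1 - z ∈ Complex.slitPlane} ≤ nhdsWithin 1 {1}ᶜ :=
    nhdsWithin_mono _ fun w hw h => by
      rw [Set.mem_singleton_iff] at h
      simp [h] at hw
  have hzero : Filter.Tendsto (fun w : ℂ => polylog 2 (1 - w))
      (nhdsWithin 1 {z : ℂ | 1 - z ∈ Complex.slitPlane}) (nhds 0) := by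
    have hc : ContinuousAt (fun w : ℂ => polylog 2 (1 - w)) 1 := by
      refine ContinuousAt.comp (g := polylog 2) (f := fun w : ℂ => 1 - w) ?_ (by fun_prop)
      exact (differentiableAt_polylog 2 (by simp)).continuousAt
    simpa [polylog_zero_right] using hc.tendsto.mono_left nhdsWithin_le_nhds
  have h := (tendsto_const_nhds (x := (Real.pi : ℂ) ^ 2 / 6)).sub
    (hzero.add (tendsto_log_mul_log_one_sub.mono_left hle))
  simp only [add_zero, sub_zero] at h
  refine h.congr' ?_
  filter_upwards [self_mem_nhdsWithin,
    nhdsWithin_le_nhds (Complex.isOpen_slitPlane.mem_nhds Complex.one_mem_slitPlane)] with w h1 h2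
  rw [← polylog_two_reflection h2 h1]
  ring

/-- Near `1` the derivative `Li₂(w) / w` of `Li₃` is bounded, so `Li₃(1 + i x)` differs by `O(x)`
from the real number `Li₃(1 - x)`. -/
theorem tendsto_polylog_three_im :
    Filter.Tendsto (fun x : ℝ => (polylog 3 (1 + x * Complex.I)).im) (nhdsWithin 0 (Set.Ioi 0))
      (nhds 0) := by
  have hb : ∀ᶠ w in nhdsWithin (1 : ℂ) {z : ℂ | 1 - z ∈ Complex.slitPlane},
      ‖polylog 2 w / w‖ < Real.pi ^ 2 / 6 + 1 ∧ w ≠ 0 := by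
    have h1 : Filter.Tendsto (fun w : ℂ => ‖polylog 2 w / w‖)
        (nhdsWithin 1 {z : ℂ | 1 - z ∈ Complex.slitPlane}) (nhds (Real.pi ^ 2 / 6)) := by
      have := (tendsto_polylog_two_nhdsWithin_one.div
        (Filter.tendsto_id.mono_left nhdsWithin_le_nhds) one_ne_zero).norm
      simpa [abs_of_pos Real.pi_pos] using this
    exact (h1.eventually_lt_const (lt_add_one _)).and
      (nhdsWithin_le_nhds (isOpen_ne.mem_nhds one_ne_zero))
  rw [eventually_nhdsWithin_iff, Metric.eventually_nhds_iff] at hb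
  obtain ⟨δ, hδ, hb⟩ := hb
  have hlim : Filter.Tendsto (fun x : ℝ => (Real.pi ^ 2 / 6 + 1) * (2 * x))
      (nhdsWithin 0 (Set.Ioi 0)) (nhds 0) := by
    have : Continuous fun x : ℝ => (Real.pi ^ 2 / 6 + 1) * (2 * x) := by fun_prop
    simpa using (this.tendsto 0).mono_left nhdsWithin_le_nhds
  refine squeeze_zero_norm' ?_ hlim
  filter_upwards [self_mem_nhdsWithin,
    nhdsWithin_le_nhds (gt_mem_nhds (half_pos hδ))] with x hx0 hx1
  have hx0 : 0 < x := hx0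
  set a : ℂ := ((1 - x : ℝ) : ℂ) with ha
  set b : ℂ := 1 + x * Complex.I with hb'
  have hseg : ∀ w ∈ segment ℝ a b, 1 - w ∈ Complex.slitPlane ∧ dist w 1 < δ := by
    rintro w ⟨s, t, hs, ht, hst, rfl⟩
    have e : s • a + t • b = 1 + ((-(s * x) : ℝ) : ℂ) + ((t * x : ℝ) : ℂ) * Complex.I := by
      have : (s : ℂ) + t = 1 := by exact_mod_cast hst
      rw [ha, hb', Complex.real_smul, Complex.real_smul]
      push_cast
      linear_combination this
    rw [e]
    constructor
    · rw [Complex.mem_slitPlane_iff]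
      rcases ht.eq_or_lt with h | h
      · left
        have : s = 1 := by linarith
        simp [this, hx0]
      · right
        simp [h.ne', hx0.ne']
    · rw [dist_eq_norm]
      refine lt_of_le_of_lt (Complex.norm_le_abs_re_add_abs_im _) ?_
      simp only [Complex.sub_re, Complex.add_re, Complex.one_re, Complex.ofReal_re,
        Complex.mul_re, Complex.I_re, Complex.ofReal_im, Complex.I_im, Complex.sub_im,
        Complex.add_im, Complex.one_im, Complex.mul_im]
      have h1 : s * x ≤ x := mul_le_of_le_one_left hx0.le (by linarith)
      have h2 : t * x ≤ x := mul_le_of_le_one_left hx0.le (by linarith)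
      have h3 : 0 ≤ s * x := by positivity
      have h4 : 0 ≤ t * x := by positivity
      have e1 : 1 + -(s * x) + (t * x * 0 - 0 * 1) - 1 = -(s * x) := by ring
      have e2 : 0 + 0 + (t * x * 1 + 0 * 0) - 0 = t * x := by ring
      rw [e1, e2, abs_neg, abs_of_nonneg h3, abs_of_nonneg h4]
      linarith
  have hmv := (convex_segment a b).norm_image_sub_le_of_norm_hasDerivWithin_le
    (f := polylog 3) (f' := fun w => polylog 2 w / w) (C := Real.pi ^ 2 / 6 + 1)
    (fun w hw => (hasDerivAt_polylog_succ 2 (hseg w hw).1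
      (hb (hseg w hw).2 (hseg w hw).1).2).hasDerivWithinAt)
    (fun w hw => (hb (hseg w hw).2 (hseg w hw).1).1.le)
    (left_mem_segment ℝ a b) (right_mem_segment ℝ a b)
  have hab : ‖b - a‖ ≤ 2 * x := by
    have : b - a = (x : ℂ) + x * Complex.I := by rw [ha, hb']; push_cast; ring
    rw [this]
    refine (norm_add_le _ _).trans ?_
    rw [norm_mul, Complex.norm_I, Complex.norm_real, Real.norm_of_nonneg hx0.le]
    linarith
  have him : (polylog 3 b).im = (polylog 3 b - polylog 3 a).im := by
    rw [Complex.sub_im, ha, polylog_ofReal_im, sub_zero]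
  rw [him, Real.norm_eq_abs]
  refine (Complex.abs_im_le_norm _).trans (hmv.trans ?_)
  gcongr

/-! ### Special values -/

theorem one_sub_neg_mul_I_mem_slitPlane (x : ℝ) : 1 - -(x * Complex.I) ∈ Complex.slitPlane := by
  simp [Complex.mem_slitPlane_iff]

theorem log_one_add_I :
    Complex.log (1 + Complex.I) = (Real.log 2 / 2 : ℝ) + (Real.pi / 4 : ℝ) * Complex.I := by
  have h : (1 : ℂ) + Complex.I = (√2 : ℝ) * (Complex.cos (Real.pi / 4 : ℝ)
      + Complex.sin (Real.pi / 4 : ℝ) * Complex.I) := by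
    have h2 : √2 * (√2 / 2) = 1 := by
      rw [← mul_div_assoc, Real.mul_self_sqrt zero_le_two, div_self two_ne_zero]
    rw [← Complex.ofReal_cos, ← Complex.ofReal_sin, Real.cos_pi_div_four, Real.sin_pi_div_four,
      mul_add, ← mul_assoc, ← Complex.ofReal_mul, h2]
    simp
  have h2 : (0 : ℝ) < √2 := by positivity
  have hpi := Real.pi_pos
  have harg : (1 + Complex.I).arg = Real.pi / 4 := by
    rw [h, Complex.arg_mul_cos_add_sin_mul_I h2 ⟨by linarith, by linarith⟩]
  have hnorm : ‖1 + Complex.I‖ = √2 := by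
    rw [Complex.norm_def, Complex.normSq_apply]
    norm_num
  rw [Complex.log, harg, hnorm, Real.log_sqrt zero_le_two]

theorem hasSum_polylog_two {z : ℂ} (hz : ‖z‖ ≤ 1) (hz' : 1 - z ∈ Complex.slitPlane) :
    HasSum (fun k : ℕ => z ^ (k + 1) / ((k : ℂ) + 1) ^ 2) (polylog 2 z) := by
  rw [polylog_two_eq_tsum hz hz']
  refine Summable.hasSum (Summable.of_norm_bounded (g := fun k : ℕ => 1 / ((k : ℝ) + 1) ^ 2) ?_ ?_)
  · exact_mod_cast (summable_nat_add_iff 1).2 (Real.summable_one_div_nat_pow.2 one_lt_two)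
  · intro k
    rw [norm_div, norm_pow, norm_pow, ← Nat.cast_add_one, Complex.norm_natCast]
    gcongr
    · exact pow_le_one₀ (norm_nonneg _) hz
    · push_cast
      rfl

theorem neg_mul_I_pow_odd (x : ℝ) (k : ℕ) :
    (-((x : ℂ) * Complex.I)) ^ (2 * k + 1)
      = ((-((-1) ^ k * x ^ (2 * k + 1)) : ℝ) : ℂ) * Complex.I := by
  have h : (-((x : ℂ) * Complex.I)) ^ 2 = -1 * (x : ℂ) ^ 2 := by
    rw [neg_sq, mul_pow, Complex.I_sq]
    ring
  rw [pow_succ, pow_mul, h, mul_pow, ← pow_mul]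
  push_cast
  ring

theorem neg_mul_I_pow_even (x : ℝ) (k : ℕ) :
    (-((x : ℂ) * Complex.I)) ^ (2 * k) = (((-1) ^ k * x ^ (2 * k) : ℝ) : ℂ) := by
  have h : (-((x : ℂ) * Complex.I)) ^ 2 = -1 * (x : ℂ) ^ 2 := by
    rw [neg_sq, mul_pow, Complex.I_sq]
    ring
  rw [pow_mul, h, mul_pow, ← pow_mul]
  push_cast
  ring

/-- The inverse tangent integral `Ti₂(x) = ∫₀ˣ arctan u / u du`, as `-Im Li₂(-i x)`. -/
noncomputable def invTanIntegral (x : ℝ) : ℝ := -(polylog 2 (-(x * Complex.I))).im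

theorem hasSum_invTanIntegral {x : ℝ} (h0 : 0 ≤ x) (h1 : x ≤ 1) :
    HasSum (fun k : ℕ => (-1) ^ k * x ^ (2 * k + 1) / (2 * (k : ℝ) + 1) ^ 2)
      (invTanIntegral x) := by
  have hn : ‖-((x : ℂ) * Complex.I)‖ ≤ 1 := by
    rw [norm_neg, norm_mul, Complex.norm_I, mul_one, Complex.norm_real, Real.norm_of_nonneg h0]
    exact h1
  have h := (Complex.hasSum_im
    (hasSum_polylog_two hn (one_sub_neg_mul_I_mem_slitPlane x))).neg
  have hinj : Function.Injective fun k : ℕ => 2 * k := fun a b h => by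
    simpa using h
  have h' := (hinj.hasSum_iff ?_).2 h
  · convert! h' using 1
    funext k
    have e : ((2 * k : ℕ) : ℂ) + 1 = ((2 * k + 1 : ℝ) : ℂ) := by push_cast; ring
    rw [Function.comp_apply, neg_mul_I_pow_odd, e, ← Complex.ofReal_pow, Complex.div_ofReal_im,
      Complex.im_ofReal_mul, Complex.I_im]
    ring
  · intro k hk
    have hodd : Odd k := by
      rw [← Nat.not_even_iff_odd]
      rintro ⟨j, rfl⟩
      exact hk ⟨j, by simp [two_mul]⟩
    obtain ⟨j, rfl⟩ := hodd
    have e : ((2 * j + 1 : ℕ) : ℂ) + 1 = ((2 * j + 2 : ℝ) : ℂ) := by push_cast; ring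
    rw [show 2 * j + 1 + 1 = 2 * (j + 1) by ring, neg_mul_I_pow_even, e, ← Complex.ofReal_pow,
      ← Complex.ofReal_div, Complex.ofReal_im, neg_zero]

/-- The even-indexed terms of `∑ 1 / k ^ 2` add up to a quarter of the whole sum. -/
theorem hasSum_alternating_zeta_two :
    HasSum (fun k : ℕ => (-1 : ℝ) ^ k / ((k : ℝ) + 1) ^ 2) (Real.pi ^ 2 / 12) := by
  have hs : HasSum (fun k : ℕ => 1 / ((k : ℝ) + 1) ^ 2) (Real.pi ^ 2 / 6) := by
    simpa using (hasSum_nat_add_iff' 1).2 hasSum_zeta_two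
  have heven : Summable fun k : ℕ => 1 / (((2 * k : ℕ) : ℝ) + 1) ^ 2 :=
    hs.summable.comp_injective fun a b h => by simpa using h
  have hodd : HasSum (fun k : ℕ => 1 / (((2 * k + 1 : ℕ) : ℝ) + 1) ^ 2) (Real.pi ^ 2 / 24) := by
    have := hs.mul_left (1 / 4)
    convert! this using 1
    · funext k
      push_cast
      field_simp
      ring
    · ring
  have hval := (heven.hasSum.even_add_odd (f := fun k : ℕ => 1 / ((k : ℝ) + 1) ^ 2) hodd).unique hs
  have h1 := heven.hasSum
  rw [eq_sub_of_add_eq hval] at h1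
  have h2 := HasSum.even_add_odd (f := fun k : ℕ => (-1 : ℝ) ^ k / ((k : ℝ) + 1) ^ 2)
    (m := Real.pi ^ 2 / 6 - Real.pi ^ 2 / 24) (m' := -(Real.pi ^ 2 / 24))
    (by simpa [pow_mul] using h1) (by simpa [pow_succ, pow_mul, neg_div] using hodd.neg)
  convert! h2 using 1
  ring

theorem polylog_two_neg_I :
    polylog 2 (-Complex.I) = (-(Real.pi ^ 2 / 48) : ℝ) + (-catalanConst : ℝ) * Complex.I := by
  have him : (polylog 2 (-Complex.I)).im = -catalanConst := by
    have h := (hasSum_invTanIntegral zero_le_one le_rfl).tsum_eq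
    simp only [one_pow, mul_one] at h
    rw [catalanConst, h, invTanIntegral]
    simp
  have hre : (polylog 2 (-Complex.I)).re = -(Real.pi ^ 2 / 48) := by
    have hz : 1 - -Complex.I ∈ Complex.slitPlane := by
      simpa using one_sub_neg_mul_I_mem_slitPlane 1
    have h := Complex.hasSum_re (hasSum_polylog_two (z := -Complex.I) (by simp) hz)
    have hinj : Function.Injective fun k : ℕ => 2 * k + 1 := fun a b h => by
      simpa using h
    refine ((hinj.hasSum_iff ?_).2 h).unique ?_
    · intro k hk
      have hev : Even k := by
        rw [← Nat.not_odd_iff_even]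
        rintro ⟨j, rfl⟩
        exact hk ⟨j, rfl⟩
      obtain ⟨j, rfl⟩ := hev
      have e : ((j + j : ℕ) : ℂ) + 1 = ((2 * j + 1 : ℝ) : ℂ) := by push_cast; ring
      have h1 := neg_mul_I_pow_odd 1 j
      rw [Complex.ofReal_one, one_mul] at h1
      rw [← two_mul, h1, two_mul, e, ← Complex.ofReal_pow, mul_div_right_comm,
        ← Complex.ofReal_div, Complex.re_ofReal_mul, Complex.I_re, mul_zero]
    · have := hasSum_alternating_zeta_two.mul_left (-1 / 4)
      convert! this using 1
      · funext k
        have e : ((2 * k + 1 : ℕ) : ℂ) + 1 = ((2 * (k + 1) : ℝ) : ℂ) := by push_cast; ring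
        have h1 := neg_mul_I_pow_even 1 (k + 1)
        rw [Complex.ofReal_one, one_mul] at h1
        rw [Function.comp_apply, show 2 * k + 1 + 1 = 2 * (k + 1) by ring, h1, e,
          ← Complex.ofReal_pow, ← Complex.ofReal_div, Complex.ofReal_re]
        have : (k : ℝ) + 1 ≠ 0 := by positivity
        field_simp
        ring
      · ring
  rw [← hre, ← him, Complex.re_add_im]

theorem polylog_two_one_add_I :
    polylog 2 (1 + Complex.I) = (Real.pi ^ 2 / 16 : ℝ)
      + (catalanConst + Real.pi * Real.log 2 / 4 : ℝ) * Complex.I := by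
  have h := polylog_two_reflection (z := 1 + Complex.I) (by simp [Complex.mem_slitPlane_iff])
    (by simp [Complex.mem_slitPlane_iff])
  have e : 1 - (1 + Complex.I) = -Complex.I := by ring
  rw [e, polylog_two_neg_I, Complex.log_neg_I, log_one_add_I] at h
  push_cast at h ⊢
  linear_combination h + (Real.pi ^ 2 / 8 : ℂ) * Complex.I_sq

/-! ### The series for `n = 0` -/

theorem HasDerivAt.complex_re {f : ℝ → ℂ} {f' : ℂ} {x : ℝ} (h : HasDerivAt f f' x) :
    HasDerivAt (fun x => (f x).re) f'.re x :=
  Complex.reCLM.hasFDerivAt.comp_hasDerivAt x h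

theorem HasDerivAt.complex_im {f : ℝ → ℂ} {f' : ℂ} {x : ℝ} (h : HasDerivAt f f' x) :
    HasDerivAt (fun x => (f x).im) f'.im x :=
  Complex.imCLM.hasFDerivAt.comp_hasDerivAt x h

theorem hasDerivAt_one_add_mul_I (x : ℝ) :
    HasDerivAt (fun x : ℝ => 1 + (x : ℂ) * Complex.I) Complex.I x := by
  simpa using ((hasDerivAt_id (x : ℂ)).mul_const Complex.I).comp_ofReal.const_add 1

theorem one_add_mul_I_mem_slitPlane (x : ℝ) : 1 + x * Complex.I ∈ Complex.slitPlane := by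
  simp [Complex.mem_slitPlane_iff]

theorem continuous_invTanIntegral : Continuous invTanIntegral := by
  have h : Continuous fun x : ℝ => polylog 2 (-(x * Complex.I)) :=
    continuous_iff_continuousAt.2 fun x =>
      ContinuousAt.comp (g := polylog 2) (f := fun x : ℝ => -((x : ℂ) * Complex.I))
        (differentiableAt_polylog 2 (one_sub_neg_mul_I_mem_slitPlane x)).continuousAt (by fun_prop)
  exact (Complex.continuous_im.comp h).neg

theorem hasDerivAt_invTanIntegral {x : ℝ} (hx : 0 < x) :
    HasDerivAt invTanIntegral ((Complex.log (1 + x * Complex.I)).im / x) x := by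
  have hx0 : (x : ℂ) ≠ 0 := by exact_mod_cast hx.ne'
  have hz := one_sub_neg_mul_I_mem_slitPlane x
  have h1 : HasDerivAt (fun x : ℝ => -((x : ℂ) * Complex.I)) (-Complex.I) x := by
    simpa using! ((hasDerivAt_id (x : ℂ)).mul_const Complex.I).comp_ofReal.neg
  have h2 := hasDerivAt_polylog_succ 1 hz (by simp [hx0])
  refine (h2.comp x h1).complex_im.neg.congr_deriv ?_
  rw [polylog_one hz, sub_neg_eq_add, ← Complex.div_ofReal_im, ← Complex.neg_im]
  congr 1
  field_simp

/-- An antiderivative of `z ↦ -log (z) ^ 2 / (1 - z)`, built from polylogarithms. -/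
noncomputable def logSqPrimitive (z : ℂ) : ℂ :=
  Complex.log (1 - z) * Complex.log z ^ 2 + 2 * Complex.log z * polylog 2 z - 2 * polylog 3 z

theorem hasDerivAt_logSqPrimitive {z : ℂ} (hz : z ∈ Complex.slitPlane)
    (hz' : 1 - z ∈ Complex.slitPlane) :
    HasDerivAt logSqPrimitive (-(Complex.log z ^ 2 / (1 - z))) z := by
  have hz0 := Complex.slitPlane_ne_zero hz
  have hz0' := Complex.slitPlane_ne_zero hz'
  have hsub : HasDerivAt (fun w : ℂ => 1 - w) (-1) z := by
    simpa using (hasDerivAt_id z).const_sub 1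
  have d1 := (hsub.clog hz').mul ((Complex.hasDerivAt_log hz).pow 2)
  have d2 := ((Complex.hasDerivAt_log hz).const_mul 2).mul (hasDerivAt_polylog_succ 1 hz' hz0)
  have d3 := (hasDerivAt_polylog_succ 2 hz' hz0).const_mul 2
  rw [polylog_one hz'] at d2
  refine ((d1.add d2).sub d3).congr_deriv ?_
  simp only [Pi.pow_apply]
  norm_num
  field_simp
  ring

/-- An antiderivative of `x Ti₂(x) / (1 + x ^ 2)` on `(0, ∞)`, from integration by parts and the
identity `ln (1 + x ^ 2) arctan x = Im (log (1 + i x) ^ 2)`. -/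
noncomputable def thetaPrimitive (x : ℝ) : ℝ :=
  (Complex.log (1 + x * Complex.I)).re * invTanIntegral x
    - (logSqPrimitive (1 + x * Complex.I)).im / 2

theorem one_sub_one_add_mul_I_mem_slitPlane {x : ℝ} (hx : 0 < x) :
    1 - (1 + x * Complex.I) ∈ Complex.slitPlane := by
  simp [Complex.mem_slitPlane_iff, hx.ne']

theorem hasDerivAt_thetaPrimitive {x : ℝ} (hx : 0 < x) :
    HasDerivAt thetaPrimitive (x * invTanIntegral x / (1 + x ^ 2)) x := by
  have hx0 : (x : ℂ) ≠ 0 := by exact_mod_cast hx.ne'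
  have hw := one_add_mul_I_mem_slitPlane x
  have hw' := one_sub_one_add_mul_I_mem_slitPlane hx
  have d1 := ((hasDerivAt_one_add_mul_I x).clog_real hw).complex_re.mul
    (hasDerivAt_invTanIntegral hx)
  have d2 : HasDerivAt (fun x : ℝ => logSqPrimitive (1 + x * Complex.I))
      (Complex.log (1 + x * Complex.I) ^ 2 / x) x := by
    refine ((hasDerivAt_logSqPrimitive hw hw').comp x (hasDerivAt_one_add_mul_I x)).congr_deriv ?_
    rw [show 1 - (1 + x * Complex.I) = -(x * Complex.I) by ring]
    field_simp
  refine (d1.sub (d2.complex_im.div_const 2)).congr_deriv ?_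
  have e : (Complex.I / (1 + x * Complex.I)).re = x / (1 + x ^ 2) := by
    rw [Complex.div_re, Complex.normSq_apply]
    simp
    ring
  rw [e, Complex.div_ofReal_im, sq (Complex.log _), Complex.mul_im]
  field_simp
  ring

theorem tendsto_thetaPrimitive_zero :
    Filter.Tendsto thetaPrimitive (nhdsWithin 0 (Set.Ioi 0)) (nhds 0) := by
  have hw : Filter.Tendsto (fun x : ℝ => 1 + (x : ℂ) * Complex.I) (nhdsWithin 0 (Set.Ioi 0))
      (nhdsWithin 1 {z : ℂ | 1 - z ∈ Complex.slitPlane}) := by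
    refine tendsto_nhdsWithin_iff.2 ⟨?_, ?_⟩
    · have : Continuous fun x : ℝ => 1 + (x : ℂ) * Complex.I := by fun_prop
      simpa using (this.tendsto 0).mono_left nhdsWithin_le_nhds
    · filter_upwards [self_mem_nhdsWithin] with x hx
        using one_sub_one_add_mul_I_mem_slitPlane hx
  have hw1 : Filter.Tendsto (fun x : ℝ => 1 + (x : ℂ) * Complex.I) (nhdsWithin 0 (Set.Ioi 0))
      (nhdsWithin 1 {1}ᶜ) := hw.mono_right <| nhdsWithin_mono _ fun w hw h => by
    rw [Set.mem_singleton_iff] at h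
    simp [h] at hw
  have hlog : Filter.Tendsto (fun x : ℝ => Complex.log (1 + x * Complex.I))
      (nhdsWithin 0 (Set.Ioi 0)) (nhds 0) := by
    have := ((continuousAt_clog Complex.one_mem_slitPlane).tendsto.mono_left
      nhdsWithin_le_nhds).comp hw
    simpa using! this
  have hT : Filter.Tendsto invTanIntegral (nhdsWithin 0 (Set.Ioi 0)) (nhds 0) := by
    have := continuous_invTanIntegral.tendsto 0
    rw [show invTanIntegral 0 = 0 by simp [invTanIntegral, polylog_zero_right]] at this
    exact this.mono_left nhdsWithin_le_nhds
  have h1 : Filter.Tendsto (fun x : ℝ => (Complex.log (1 + x * Complex.I)).re)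
      (nhdsWithin 0 (Set.Ioi 0)) (nhds 0) := by
    simpa using! (Complex.continuous_re.tendsto 0).comp hlog
  -- All of `logSqPrimitive` but the trilogarithm, of which only the imaginary part vanishes.
  have h2 : Filter.Tendsto (fun x : ℝ => Complex.log (1 + x * Complex.I)
      * Complex.log (1 - (1 + x * Complex.I)) * Complex.log (1 + x * Complex.I)
      + 2 * Complex.log (1 + x * Complex.I) * polylog 2 (1 + x * Complex.I))
      (nhdsWithin 0 (Set.Ioi 0)) (nhds 0) := by
    simpa using ((tendsto_log_mul_log_one_sub.comp hw1).mul hlog).add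
      ((hlog.const_mul 2).mul (tendsto_polylog_two_nhdsWithin_one.comp hw))
  have h3 := ((Complex.continuous_im.tendsto 0).comp h2).sub (tendsto_polylog_three_im.const_mul 2)
  have h4 := (h1.mul hT).sub (h3.div_const 2)
  simp only [Complex.zero_im, mul_zero, sub_zero, zero_div] at h4
  refine h4.congr fun x => ?_
  rw [thetaPrimitive, logSqPrimitive, Complex.sub_im]
  simp only [Function.comp_apply]
  rw [show (2 * polylog 3 (1 + x * Complex.I)).im = 2 * (polylog 3 (1 + x * Complex.I)).im by simp]
  congr 4
  ring

theorem thetaPrimitive_one :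
    4 * thetaPrimitive 1 = -(Real.pi * Real.log 2 ^ 2 / 4) - Real.pi ^ 3 / 8
      + 4 * (polylog 3 (1 + Complex.I)).im := by
  have hT : invTanIntegral 1 = catalanConst := by
    rw [invTanIntegral, Complex.ofReal_one, one_mul, polylog_two_neg_I, Complex.add_im,
      Complex.ofReal_im, Complex.im_ofReal_mul, Complex.I_im]
    ring
  have e : 1 - (1 + Complex.I) = -Complex.I := by ring
  rw [thetaPrimitive, hT, Complex.ofReal_one, one_mul, logSqPrimitive, e, Complex.log_neg_I,
    polylog_two_one_add_I, log_one_add_I]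
  simp only [sq, Complex.sub_im, Complex.add_im, Complex.add_re, Complex.mul_im, Complex.mul_re,
    Complex.ofReal_im, Complex.ofReal_re, Complex.I_im, Complex.I_re, Complex.neg_im,
    Complex.neg_re, Complex.re_ofNat, Complex.im_ofNat]
  norm_num
  ring

theorem integral_mul_invTanIntegral :
    ∫ x in (0 : ℝ)..1, x * invTanIntegral x / (1 + x ^ 2) = thetaPrimitive 1 := by
  have hc : Continuous fun x : ℝ => x * invTanIntegral x / (1 + x ^ 2) :=
    (continuous_id.mul continuous_invTanIntegral).div (by fun_prop)
      fun x => (by positivity : (0 : ℝ) < 1 + x ^ 2).ne'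
  have h := intervalIntegral.integral_eq_sub_of_hasDerivAt_of_tendsto (zero_lt_one' ℝ)
    (fun x hx => hasDerivAt_thetaPrimitive hx.1) (hc.intervalIntegrable 0 1)
    tendsto_thetaPrimitive_zero
    ((hasDerivAt_thetaPrimitive one_pos).continuousAt.tendsto.mono_left nhdsWithin_le_nhds)
  rw [h, sub_zero]

theorem hasSum_theta_zero :
    HasSum (thetaTwoRealTerm 0)
      (-4 + (1 - 1 / 4 * Real.log 2 ^ 2) * Real.pi - Real.pi ^ 3 / 8
        + 4 * (polylog 3 (1 + Complex.I)).im) := by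
  let f : ℕ → C(ℝ, ℝ) := fun k =>
    ⟨fun x => (-1) ^ (k + 1) / (2 * (k : ℝ) + 3) ^ 2
      * (4 * x ^ (2 * (k + 0 + 2)) / (1 + x ^ 2)),
      continuous_const.mul (continuous_arctanMoment_integrand _)⟩
  have hsum : Summable fun k : ℕ => 4 * (1 / ((k + 1 : ℕ) : ℝ) ^ 2) :=
    ((summable_nat_add_iff 1).2 (Real.summable_one_div_nat_pow.2 one_lt_two)).mul_left 4
  have hb : Summable fun k : ℕ => ‖(f k).restrict
      (⟨Set.uIcc (0 : ℝ) 1, isCompact_uIcc⟩ : TopologicalSpace.Compacts ℝ)‖ := by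
    refine Summable.of_nonneg_of_le (fun _ => norm_nonneg _) (fun k => ?_) hsum
    refine (ContinuousMap.norm_le _ (by positivity)).2 ?_
    rintro ⟨x, hx⟩
    have hx : x ∈ Set.uIcc (0 : ℝ) 1 := hx
    rw [Set.uIcc_of_le zero_le_one] at hx
    have hx0 := hx.1
    simp only [f, ContinuousMap.restrict_apply, ContinuousMap.coe_mk, norm_mul, norm_div, norm_pow,
      norm_neg, norm_one, one_pow]
    rw [Real.norm_of_nonneg (by positivity : (0 : ℝ) ≤ 2 * (k : ℝ) + 3),
      Real.norm_of_nonneg hx0, Real.norm_of_nonneg (by positivity : (0 : ℝ) ≤ 1 + x ^ 2),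
      mul_comm (4 : ℝ)]
    have h1 : x ^ (2 * (k + 0 + 2)) ≤ 1 := pow_le_one₀ hx0 hx.2
    have h2 : ‖(4 : ℝ)‖ * x ^ (2 * (k + 0 + 2)) / (1 + x ^ 2) ≤ 4 := by
      rw [Real.norm_of_nonneg (by norm_num : (0 : ℝ) ≤ 4), div_le_iff₀ (by positivity)]
      nlinarith [sq_nonneg x]
    refine mul_le_mul ?_ h2 (by positivity) (by positivity)
    gcongr
    push_cast
    linarith [(Nat.cast_nonneg k : (0 : ℝ) ≤ (k : ℝ))]
  have h := intervalIntegral.hasSum_intervalIntegral_of_summable_norm (f := f) (a := 0) (b := 1) hb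
  have hval : ∫ x in (0 : ℝ)..1, ∑' k : ℕ, f k x
      = 4 * thetaPrimitive 1 - arctanMoment 1 := by
    rw [← integral_mul_invTanIntegral, ← intervalIntegral.integral_const_mul, arctanMoment,
      ← intervalIntegral.integral_sub]
    · refine intervalIntegral.integral_congr fun x hx => ?_
      rw [Set.uIcc_of_le zero_le_one] at hx
      have h1 := ((hasSum_nat_add_iff' 1).2 (hasSum_invTanIntegral hx.1 hx.2)).mul_left
        (4 * x / (1 + x ^ 2))
      refine HasSum.tsum_eq ?_
      convert! h1 using 1
      · funext k
        have e : 2 * ((k + 1 : ℕ) : ℝ) + 1 = 2 * k + 3 := by push_cast; ring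
        simp only [f, ContinuousMap.coe_mk]
        rw [e]
        ring
      · simp
        ring
    · refine (Continuous.intervalIntegrable ?_ _ _)
      exact continuous_const.mul ((continuous_id.mul continuous_invTanIntegral).div (by fun_prop)
        fun x => (by positivity : (0 : ℝ) < 1 + x ^ 2).ne')
    · exact (continuous_arctanMoment_integrand 1).intervalIntegrable _ _
  -- `J(1) = 4 - J(0) = 4 - π`.
  have hJ := arctanMoment_add_succ 0
  rw [arctanMoment_zero] at hJ
  norm_num at hJ
  rw [hval, thetaPrimitive_one] at h
  convert! h using 1
  · funext k
    simp only [f, ContinuousMap.coe_mk]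
    rw [intervalIntegral.integral_const_mul, thetaTwoRealTerm, arctanMoment]
    ring
  · linarith

/-! ### The recurrence in `n` -/

/-- The partial sum `∑ (-1) ^ j / (2 j + 1)`, `j < N`, of Leibniz's series for `π / 4`. -/
noncomputable def leibnizSum (N : ℕ) : ℝ := ∑ j ∈ Finset.range N, (-1 : ℝ) ^ j / (2 * (j : ℝ) + 1)

theorem leibnizSum_succ (N : ℕ) :
    leibnizSum (N + 1) = leibnizSum N + (-1 : ℝ) ^ N / (2 * (N : ℝ) + 1) :=
  Finset.sum_range_succ _ _

theorem tendsto_leibnizSum : Filter.Tendsto leibnizSum Filter.atTop (nhds (Real.pi / 4)) :=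
  Real.tendsto_sum_pi_div_four

/-- The value of `Θ₂(m - 1, 1) + Θ₂(m, 1)`. -/
noncomputable def thetaStep (m : ℕ) : ℝ :=
  2 / m * (catalanConst - 1)
    - ((Real.pi / 4 - 1) - (-1) ^ m * (Real.pi / 4 - leibnizSum (m + 1))) / (m : ℝ) ^ 2

theorem summable_theta (n : ℕ) :
    Summable (thetaTwoRealTerm n) := by
  have hsum : Summable fun k : ℕ => 4 * (1 / ((k + 1 : ℕ) : ℝ) ^ 2) :=
    ((summable_nat_add_iff 1).2 (Real.summable_one_div_nat_pow.2 one_lt_two)).mul_left 4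
  refine Summable.of_norm_bounded hsum fun k => ?_
  rw [thetaTwoRealTerm, norm_div, norm_mul, norm_pow, norm_neg, norm_one, one_pow, one_mul,
    Real.norm_of_nonneg (arctanMoment_nonneg _), norm_pow,
    Real.norm_of_nonneg (by positivity : (0 : ℝ) ≤ 2 * (k : ℝ) + 3), mul_one_div]
  have h : arctanMoment (k + n + 2) ≤ 4 := (arctanMoment_le _).trans
    (div_le_self (by norm_num) (le_add_of_nonneg_left (by positivity)))
  gcongr
  push_cast
  linarith [(Nat.cast_nonneg k : (0 : ℝ) ≤ (k : ℝ))]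

theorem hasSum_catalanConst_sub_one :
    HasSum (fun k : ℕ => (-1 : ℝ) ^ (k + 1) / (2 * (k : ℝ) + 3) ^ 2)
      (catalanConst - 1) := by
  have h := hasSum_invTanIntegral zero_le_one le_rfl
  simp only [one_pow, mul_one] at h
  have h' := (hasSum_nat_add_iff' 1).2 h
  rw [← h.tsum_eq] at h'
  convert! h' using 1
  · funext k
    have e : 2 * (k : ℝ) + 3 = 2 * ((k + 1 : ℕ) : ℝ) + 1 := by push_cast; ring
    rw [e]
  · simp [catalanConst]

/-- By `arctanMoment_add_succ` the two series add up to
`∑ (-1) ^ k * 4 / ((2 k + 1) ^ 2 * (2 k + 1 + 2 m))`, whose partial fractions give Catalan's series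
and a telescoping sum of values of `leibnizSum`. -/
theorem hasSum_thetaTwoRealTerm_succ {n : ℕ} {s : ℝ}
    (h : HasSum (thetaTwoRealTerm n) s) :
    HasSum (thetaTwoRealTerm (n + 1)) (thetaStep (n + 1) - s) := by
  set m := n + 1 with hm
  have hm0 : (m : ℝ) ≠ 0 := by positivity
  -- From `1 / (u ^ 2 (u + 2 m)) = 1 / (2 m u ^ 2) - (1 / u - 1 / (u + 2 m)) / (4 m ^ 2)` with
  -- `u = 2 k + 3`: the alternating sums of `1 / u` and `1 / (u + 2 m)` are differences of values of
  -- `leibnizSum`.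
  let d : ℕ → ℝ := fun k => -(leibnizSum (k + 1) - (-1) ^ m * leibnizSum (k + 1 + m)) / (m : ℝ) ^ 2
  have hterm : ∀ k : ℕ, thetaTwoRealTerm n k + thetaTwoRealTerm m k
      = 2 / m * ((-1 : ℝ) ^ (k + 1) / (2 * (k : ℝ) + 3) ^ 2) + (d (k + 1) - d k) := by
    intro k
    have h1 := arctanMoment_add_succ (k + 1 + m)
    have h2 := leibnizSum_succ (k + 1)
    have h3 := leibnizSum_succ (k + 1 + m)
    have hsq : ((-1 : ℝ) ^ m) * (-1) ^ m = 1 := by rw [← mul_pow]; norm_num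
    have h4 : k + 1 + 1 + m = k + 1 + m + 1 := by ring
    have hk1 : (2 * ((k + 1 : ℕ) : ℝ) + 1) ≠ 0 := by positivity
    have hk2 : (2 * (((k + 1 : ℕ) : ℝ) + m) + 1) ≠ 0 := by positivity
    have e1 : 2 * (k : ℝ) + 3 = 2 * ((k + 1 : ℕ) : ℝ) + 1 := by push_cast; ring
    simp only [d, thetaTwoRealTerm]
    rw [show k + n + 2 = k + 1 + m by omega, show k + m + 2 = k + 1 + m + 1 by ring, e1,
      ← add_div, ← mul_add, h1, h4, h3, h2, pow_add _ (k + 1) m, Nat.cast_add (k + 1) m]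
    generalize leibnizSum (k + 1) = a
    generalize leibnizSum (k + 1 + m) = b
    generalize ((k + 1 : ℕ) : ℝ) = x at *
    generalize (-1 : ℝ) ^ (k + 1) = ε
    have e : ∀ y : ℝ, (-1 : ℝ) ^ m * (b + ε * (-1) ^ m / y) = (-1) ^ m * b + ε / y := fun y => by
      linear_combination (ε / y) * hsq
    rw [e]
    field_simp
    ring
  have hsum := summable_theta n
  have hsum' := summable_theta m
  have hd : HasSum (fun k => d (k + 1) - d k)
      (-(Real.pi / 4 - (-1) ^ m * (Real.pi / 4)) / (m : ℝ) ^ 2 - d 0) := by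
    -- Leibniz's series converges only conditionally; the summability of the telescoping part comes
    -- from that of the three other series in `hterm`.
    have hs : Summable fun k => d (k + 1) - d k := by
      refine ((hsum.add hsum').sub
        (hasSum_catalanConst_sub_one.summable.mul_left (2 / (m : ℝ)))).congr fun k => ?_
      rw [hterm]
      ring
    have hlim : Filter.Tendsto d Filter.atTop
        (nhds (-(Real.pi / 4 - (-1) ^ m * (Real.pi / 4)) / (m : ℝ) ^ 2)) := by
      have h1 := tendsto_leibnizSum.comp (Filter.tendsto_add_atTop_nat 1)
      have h2 := tendsto_leibnizSum.comp (Filter.tendsto_add_atTop_nat (1 + m))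
      refine ((h1.sub (h2.const_mul ((-1) ^ m))).neg.div_const _).congr fun k => ?_
      simp only [d, Function.comp_apply, add_assoc]
    have hpart := hs.hasSum.tendsto_sum_nat
    simp only [Finset.sum_range_sub] at hpart
    rw [← tendsto_nhds_unique hpart (hlim.sub_const (d 0))]
    exact hs.hasSum
  have htot := ((hasSum_catalanConst_sub_one.mul_left (2 / (m : ℝ))).add hd).sub h
  convert! htot using 1
  · funext k
    rw [← hterm k]
    ring
  · have h0 : leibnizSum 1 = 1 := by simp [leibnizSum]
    simp only [thetaStep, d]
    rw [zero_add, h0, add_comm 1 m]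
    ring

theorem sum_Icc_one_leibniz (n : ℕ) :
    ∑ j ∈ Finset.Icc 1 n, (-1 : ℝ) ^ j / (2 * (j : ℝ) + 1) = leibnizSum (n + 1) - 1 := by
  induction n with
  | zero => simp [leibnizSum]
  | succ n ih =>
    rw [Finset.sum_Icc_succ_top (Nat.le_add_left 1 n), ih, leibnizSum_succ (n + 1)]
    ring

theorem sum_Icc_zero_leibniz (n : ℕ) (a b c : ℝ) :
    ∑ j ∈ Finset.Icc 0 n, (-1 : ℝ) ^ j * a / (b * (2 * (j : ℝ) + 1) * c)
      = a / (b * c) * leibnizSum (n + 1) := by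
  rw [leibnizSum, Finset.mul_sum, Nat.range_succ_eq_Icc_zero]
  refine Finset.sum_congr rfl fun j _ => ?_
  rw [div_mul_div_comm]
  congr 1 <;> ring

/-! ### The closed forms -/

theorem leibnizSum_two_mul_add_two (p : ℕ) :
    leibnizSum (2 * p + 2) = leibnizSum (2 * p + 1) - 1 / (4 * p + 3) := by
  rw [leibnizSum_succ (2 * p + 1), pow_succ, pow_mul]
  push_cast
  rw [show 2 * (2 * (p : ℝ) + 1) + 1 = 4 * p + 3 by ring]
  norm_num
  ring

theorem leibnizSum_two_mul_add_three (p : ℕ) :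
    leibnizSum (2 * p + 3) = leibnizSum (2 * p + 2) + 1 / (4 * p + 5) := by
  rw [leibnizSum_succ (2 * p + 2), show 2 * p + 2 = 2 * (p + 1) by ring, pow_mul]
  push_cast
  rw [show 2 * (2 * ((p : ℝ) + 1)) + 1 = 4 * p + 5 by ring]
  norm_num

theorem thetaStep_two_mul_add_one (p : ℕ) :
    thetaStep (2 * p + 1) = 2 / (2 * p + 1) * (catalanConst - 1)
      - (Real.pi / 2 - 1 - leibnizSum (2 * p + 2)) / (2 * (p : ℝ) + 1) ^ 2 := by
  rw [thetaStep, pow_succ _ (2 * p), pow_mul]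
  push_cast
  norm_num
  ring

theorem thetaStep_two_mul_add_two (p : ℕ) :
    thetaStep (2 * p + 2) = 1 / (p + 1) * (catalanConst - 1)
      - (leibnizSum (2 * p + 3) - 1) / (4 * ((p : ℝ) + 1) ^ 2) := by
  have h : (p : ℝ) + 1 ≠ 0 := by positivity
  rw [thetaStep, show (-1 : ℝ) ^ (2 * p + 2) = 1 by
    rw [show 2 * p + 2 = 2 * (p + 1) by ring, pow_mul]; norm_num]
  push_cast
  rw [show 2 * (p : ℝ) + 2 = 2 * (p + 1) by ring]
  field_simp
  ring

theorem hasSum_theta_even (p : ℕ) :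
    HasSum (thetaTwoRealTerm (2 * p))
      (-4 + 1 / 4 * ∑ j ∈ Finset.Icc 1 p, 1 / ((j : ℝ) ^ 2 * (4 * (j : ℝ) - 1))
        - 4 * ∑ j ∈ Finset.Icc 1 (2 * p), (-1 : ℝ) ^ j / (2 * (j : ℝ) + 1)
        - 1 / 4 * ∑ k ∈ Finset.Icc 1 p, ∑ j ∈ Finset.Icc 0 (2 * k - 2),
            (-1 : ℝ) ^ j * (8 * (k : ℝ) ^ 2 - 4 * (k : ℝ) + 1)
              / ((k : ℝ) ^ 2 * (2 * (j : ℝ) + 1) * (2 * (k : ℝ) - 1) ^ 2)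
        + (1 + 1 / 2 * ∑ j ∈ Finset.Icc 1 p, 1 / (2 * (j : ℝ) - 1) ^ 2
            - 1 / 4 * Real.log 2 ^ 2) * Real.pi
        - Real.pi ^ 3 / 8
        - catalanConst * ∑ j ∈ Finset.Icc 1 p, 1 / ((j : ℝ) * (2 * (j : ℝ) - 1))
        + 4 * (polylog 3 (1 + Complex.I)).im) := by
  induction p with
  | zero => simpa using! hasSum_theta_zero
  | succ p ih =>
    have h := hasSum_thetaTwoRealTerm_succ (hasSum_thetaTwoRealTerm_succ ih)
    refine Eq.subst (motive := HasSum (thetaTwoRealTerm (2 * (p + 1)))) ?_ h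
    have e1 : 2 * (p + 1) - 2 = 2 * p := by omega
    have hp1 : (p : ℝ) + 1 ≠ 0 := by positivity
    have hp2 : 2 * (p : ℝ) + 1 ≠ 0 := by positivity
    have hp3 : 4 * (p : ℝ) + 3 ≠ 0 := by positivity
    have hp4 : 4 * (p : ℝ) + 5 ≠ 0 := by positivity
    have q1 : 2 * ((p : ℝ) + 1) - 1 = 2 * p + 1 := by ring
    have q2 : 4 * ((p : ℝ) + 1) - 1 = 4 * p + 3 := by ring
    simp only [Finset.sum_Icc_succ_top (Nat.le_add_left 1 p)]
    rw [show 2 * p + 1 + 1 = 2 * p + 2 by ring, thetaStep_two_mul_add_two,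
      thetaStep_two_mul_add_one, sum_Icc_one_leibniz, sum_Icc_one_leibniz, sum_Icc_zero_leibniz, e1,
      show 2 * (p + 1) + 1 = 2 * p + 3 by ring, leibnizSum_two_mul_add_three,
      leibnizSum_two_mul_add_two, Nat.cast_succ, q1, q2]
    field_simp
    ring

theorem hasSum_theta_odd (p : ℕ) :
    HasSum (thetaTwoRealTerm (2 * p + 1))
      (5 - ∑ j ∈ Finset.Icc 1 p, 1 / (4 * (j : ℝ) ^ 2 * (4 * (j : ℝ) + 1))
        + 4 * ∑ j ∈ Finset.Icc 1 (2 * p + 1), (-1 : ℝ) ^ j / (2 * (j : ℝ) + 1)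
        + 1 / 4 * ∑ k ∈ Finset.Icc 1 p, ∑ j ∈ Finset.Icc 0 (2 * k),
            (-1 : ℝ) ^ j * (8 * (k : ℝ) ^ 2 + 4 * (k : ℝ) + 1)
              / ((k : ℝ) ^ 2 * (2 * (j : ℝ) + 1) * (2 * (k : ℝ) + 1) ^ 2)
        + (2 - ∑ j ∈ Finset.Icc 1 p, 1 / ((j : ℝ) * (2 * (j : ℝ) + 1))) * catalanConst
        - (3 + ∑ j ∈ Finset.Icc 1 p, 1 / (2 * (j : ℝ) + 1) ^ 2
            - 1 / 2 * Real.log 2 ^ 2) * (Real.pi / 2)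
        + Real.pi ^ 3 / 8 - 4 * (polylog 3 (1 + Complex.I)).im) := by
  induction p with
  | zero =>
    have h := hasSum_thetaTwoRealTerm_succ hasSum_theta_zero
    refine Eq.subst (motive := HasSum (thetaTwoRealTerm (2 * 0 + 1))) ?_ h
    simp [thetaStep, leibnizSum, Finset.sum_range_succ]
    ring
  | succ p ih =>
    have h := hasSum_thetaTwoRealTerm_succ (hasSum_thetaTwoRealTerm_succ ih)
    refine Eq.subst (motive := HasSum (thetaTwoRealTerm (2 * (p + 1) + 1))) ?_ h
    have hp1 : (p : ℝ) + 1 ≠ 0 := by positivity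
    have hp2 : 2 * (p : ℝ) + 3 ≠ 0 := by positivity
    have hp3 : 4 * (p : ℝ) + 7 ≠ 0 := by positivity
    have hp4 : 4 * (p : ℝ) + 5 ≠ 0 := by positivity
    have q1 : 2 * ((p : ℝ) + 1) + 1 = 2 * p + 3 := by ring
    have q2 : 4 * ((p : ℝ) + 1) + 1 = 4 * p + 5 := by ring
    have q3 : 4 * ((p : ℝ) + 1) + 3 = 4 * p + 7 := by ring
    have hB := leibnizSum_two_mul_add_two (p + 1)
    rw [show 2 * (p + 1) + 2 = 2 * p + 4 by ring, show 2 * (p + 1) + 1 = 2 * p + 3 by ring,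
      Nat.cast_succ, q3] at hB
    simp only [Finset.sum_Icc_succ_top (Nat.le_add_left 1 p)]
    rw [show 2 * p + 1 + 1 + 1 = 2 * (p + 1) + 1 by ring, show 2 * p + 1 + 1 = 2 * p + 2 by ring,
      thetaStep_two_mul_add_two, thetaStep_two_mul_add_one, sum_Icc_one_leibniz,
      sum_Icc_one_leibniz, sum_Icc_zero_leibniz, show 2 * (p + 1) + 1 + 1 = 2 * p + 4 by ring,
      show 2 * (p + 1) + 1 = 2 * p + 3 by ring,
      show 2 * p + 1 + 1 = 2 * p + 2 by ring, hB, leibnizSum_two_mul_add_three, Nat.cast_succ, q1,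
      q2]
    field_simp
    ring

theorem thetaTwoHasSum_of_hasSum {n : ℕ} {s : ℝ}
    (h : HasSum (thetaTwoRealTerm n) s) : ThetaTwoHasSum n 1 s := by
  rw [ThetaTwoHasSum]
  simp only [thetaTwoTerm_one_succ]
  exact Complex.hasSum_ofReal.2 h

theorem theorem2 (n : ℕ) :
    (n = 0 → ThetaTwoHasSum n 1
      (-4 + (1 - 1 / 4 * Real.log 2 ^ 2) * Real.pi - Real.pi ^ 3 / 8
        + 4 * (polylog 3 (1 + Complex.I)).im)) ∧
    (n = 1 → ThetaTwoHasSum n 1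
      (11 / 3 - (3 - 1 / 2 * Real.log 2 ^ 2) * (Real.pi / 2) + Real.pi ^ 3 / 8
        + 2 * catalanConst - 4 * (polylog 3 (1 + Complex.I)).im)) ∧
    (Odd n → n ≠ 1 → ThetaTwoHasSum n 1
      (5 - ∑ j ∈ Finset.Icc 1 ((n - 1) / 2), 1 / (4 * (j : ℝ) ^ 2 * (4 * (j : ℝ) + 1))
        + 4 * ∑ j ∈ Finset.Icc 1 n, (-1 : ℝ) ^ j / (2 * (j : ℝ) + 1)
        + 1 / 4 * ∑ k ∈ Finset.Icc 1 ((n - 1) / 2), ∑ j ∈ Finset.Icc 0 (2 * k),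
            (-1 : ℝ) ^ j * (8 * (k : ℝ) ^ 2 + 4 * (k : ℝ) + 1)
              / ((k : ℝ) ^ 2 * (2 * (j : ℝ) + 1) * (2 * (k : ℝ) + 1) ^ 2)
        + (2 - ∑ j ∈ Finset.Icc 1 ((n - 1) / 2), 1 / ((j : ℝ) * (2 * (j : ℝ) + 1)))
            * catalanConst
        - (3 + ∑ j ∈ Finset.Icc 1 ((n - 1) / 2), 1 / (2 * (j : ℝ) + 1) ^ 2
            - 1 / 2 * Real.log 2 ^ 2) * (Real.pi / 2)
        + Real.pi ^ 3 / 8 - 4 * (polylog 3 (1 + Complex.I)).im)) ∧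
    (Even n → ThetaTwoHasSum n 1
      (-4 + 1 / 4 * ∑ j ∈ Finset.Icc 1 (n / 2), 1 / ((j : ℝ) ^ 2 * (4 * (j : ℝ) - 1))
        - 4 * ∑ j ∈ Finset.Icc 1 n, (-1 : ℝ) ^ j / (2 * (j : ℝ) + 1)
        - 1 / 4 * ∑ k ∈ Finset.Icc 1 (n / 2), ∑ j ∈ Finset.Icc 0 (2 * k - 2),
            (-1 : ℝ) ^ j * (8 * (k : ℝ) ^ 2 - 4 * (k : ℝ) + 1)
              / ((k : ℝ) ^ 2 * (2 * (j : ℝ) + 1) * (2 * (k : ℝ) - 1) ^ 2)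
        + (1 + 1 / 2 * ∑ j ∈ Finset.Icc 1 (n / 2), 1 / (2 * (j : ℝ) - 1) ^ 2
            - 1 / 4 * Real.log 2 ^ 2) * Real.pi
        - Real.pi ^ 3 / 8
        - catalanConst * ∑ j ∈ Finset.Icc 1 (n / 2), 1 / ((j : ℝ) * (2 * (j : ℝ) - 1))
        + 4 * (polylog 3 (1 + Complex.I)).im)) := by
  refine ⟨?_, ?_, ?_, ?_⟩
  · rintro rfl
    exact thetaTwoHasSum_of_hasSum hasSum_theta_zero
  · rintro rfl
    have h := thetaTwoHasSum_of_hasSum (hasSum_theta_odd 0)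
    refine Eq.subst (motive := ThetaTwoHasSum 1 1) ?_ h
    simp
    ring
  · rintro ⟨p, rfl⟩ -
    have e : (2 * p + 1 - 1) / 2 = p := by omega
    rw [e]
    exact thetaTwoHasSum_of_hasSum (hasSum_theta_odd p)
  · rintro ⟨p, rfl⟩
    have e : (p + p) / 2 = p := by omega
    rw [e, ← two_mul]
    exact thetaTwoHasSum_of_hasSum (hasSum_theta_even p)
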